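/- Let $X$ be a separable real Banach space, $\Omega\subset X$ open, and $\Gamma\to\Omega$ a $C^3$-smooth real Banach Lie group bundle: a locally trivial bundle of groups $\Gamma_x$, $x\in\Omega$, whose fiber type is a real Banach Lie group $G$ (of class $C^3$), whose local trivializations are fiberwise group isomorphisms onto $G$, and whose changes of trivialization are of class $C^3$. Let $\dot\Gamma\to\Omega$ be the associated Banach Lie algebra bundle, $\dot\Gamma_x=T_1\Gamma_x$, with a continuous norm $|\cdot|_x:\dot\Gamma_x\to[0,\infty)$ (a norm on each fiber, continuous as a function on the total space of $\dot\Gamma$), and let $\exp_x:\dot\Gamma_x\to\Gamma_x$ be the exponential map. Let $P\to\Omega$ be a $C^3$-smooth right $\Gamma$-principal bundle, i.e., a $C^3$-smooth bundle with a fiberwise right action of $\Gamma$ that is locally $C^3$-isomorphic to $\Gamma$ acting on itself by right translations. For $p,q\in P_x$ let $p^{-1}q$ be the unique $a\in\Gamma_x$ with $pa=q$. A normal neighborhood is an open neighborhood $N\subset\dot\Gamma$ of the zero section that the map $\exp:\dot\Gamma\to\Gamma$ sends homeomorphically onto an open subset of $\Gamma$; given $N$, let $N_x=N\cap\dot\Gamma_x$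 and let $\log_x:\exp_x(N_x)\to N_x$ be the inverse of $\exp_x|_{N_x}$. A section of $P$ is locally Lipschitz if it is so in local trivializations of $P$ and charts of $G$. Normal neighborhoods exist, and the following hold. (8.2) Let $N$ be any normal neighborhood. For any continuous section $f$ of $P$ and any continuous $\varepsilon:\Omega\to(0,\infty)$ there is a locally Lipschitz section $g$ of $P$ such that, for all $x\in\Omega$, $f(x)^{-1}g(x)\in\exp_x(N_x)$ and $|\log_x f(x)^{-1}g(x)|_x\le\varepsilon(x)$. (8.1) For any continuous section $f$ of $P$ there are a locally Lipschitz section $g$ of $P$ and a continuous map $h:\Omega\times[0,1]\to P$ such that $h(x,t)\in P_x$, $h(x,0)=f(x)$ and $h(x,1)=g(x)$ for all $(x,t)\in\Omega\times[0,1]$. -/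

import Mathlib

open Set Filter Topology Bundle TopologicalSpace MulOpposite
open scoped Manifold ContDiff NNReal

noncomputable section

/-! ### `C^n` fibre bundles, Lie group bundles, principal bundles over an open set -/

section Bundles

variable {X : Type*} [NormedAddCommGroup X] [NormedSpace ℝ X] (Ω : Opens X)
  (E : Type*) [NormedAddCommGroup E] [NormedSpace ℝ E]
  (G : Type*) [TopologicalSpace G] [ChartedSpace E G]

/-- A fibre bundle `F` over the open set `Ω ⊆ X`, with typical fibre the manifold `G` modelled on
`E`, is a `C^n` bundle if the changes of trivialization
`(x, a) ↦ e' (e⁻¹ (x, a))` between members of its trivialization atlas are of class `C^n`. -/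
class IsContMDiffFiberBundle (n : WithTop ℕ∞) (F : Ω → Type*) [TopologicalSpace (TotalSpace G F)]
    [∀ x, TopologicalSpace (F x)] [FiberBundle G F] : Prop where
  contMDiffOn_coordChange : ∀ e ∈ FiberBundle.trivializationAtlas G F,
    ∀ e' ∈ FiberBundle.trivializationAtlas G F,
      ContMDiffOn (𝓘(ℝ, X).prod 𝓘(ℝ, E)) 𝓘(ℝ, E) n
        (fun p : Ω × G => (e' (e.toOpenPartialHomeomorph.symm p)).2)
        ((e.baseSet ∩ e'.baseSet) ×ˢ univ)

/-- A fibre bundle `Γ → Ω` of groups with typical fibre the Lie group `G` is a `C^n` Lie group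
bundle if it is a `C^n` bundle and its trivializations are fibrewise group homomorphisms
(hence group isomorphisms `Γ x ≃ G`). -/
class IsLieGroupBundle [Group G] (n : WithTop ℕ∞) (Γ : Ω → Type*)
    [TopologicalSpace (TotalSpace G Γ)] [∀ x, TopologicalSpace (Γ x)] [∀ x, Group (Γ x)]
    [FiberBundle G Γ] : Prop extends IsContMDiffFiberBundle Ω E G n Γ where
  map_mul : ∀ e ∈ FiberBundle.trivializationAtlas G Γ, ∀ x ∈ e.baseSet, ∀ a b : Γ x,
    (e ⟨x, a * b⟩).2 = (e ⟨x, a⟩).2 * (e ⟨x, b⟩).2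

/-- A `C^n` bundle `P → Ω` with a fibrewise right action of the group bundle `Γ → Ω` (a right
action of `Γ x` is an action of `(Γ x)ᵐᵒᵖ`) is a right `Γ`-principal bundle if it is locally
isomorphic to `Γ` acting on itself by right translations: near each point of `Ω` there are
trivializations `e` of `P` and `τ` of `Γ` with `e (p · a) = e p * τ a`. -/
class IsRightPrincipalBundle [Group G] (n : WithTop ℕ∞)
    (Γ : Ω → Type*) [TopologicalSpace (TotalSpace G Γ)] [∀ x, TopologicalSpace (Γ x)]
    [∀ x, Group (Γ x)] [FiberBundle G Γ]
    (P : Ω → Type*) [TopologicalSpace (TotalSpace G P)] [∀ x, TopologicalSpace (P x)]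
    [FiberBundle G P] [∀ x, MulAction (Γ x)ᵐᵒᵖ (P x)] : Prop
    extends IsContMDiffFiberBundle Ω E G n P where
  exists_equivariant : ∀ x₀ : Ω, ∃ e ∈ FiberBundle.trivializationAtlas G P,
    ∃ τ ∈ FiberBundle.trivializationAtlas G Γ, x₀ ∈ e.baseSet ∩ τ.baseSet ∧
      ∀ x ∈ e.baseSet ∩ τ.baseSet, ∀ (p : P x) (a : Γ x),
        (e ⟨x, op a • p⟩).2 = (e ⟨x, p⟩).2 * (τ ⟨x, a⟩).2

end Bundles

/-- In a fibre of a right principal bundle, `torsorDiv p q = p⁻¹ q` is the (unique) group element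
`a` with `p · a = q`. -/
def torsorDiv {A Q : Type*} [Group A] [MulAction Aᵐᵒᵖ Q] (p q : Q) : A :=
  Classical.epsilon fun a : A => op a • p = q

/-! ### Sections -/

section Sections

variable {X : Type*} [NormedAddCommGroup X] {Ω : Opens X}

/-- A map `u` from a metric space to a manifold modelled on `E` is locally Lipschitz at `y` if it
is continuous at `y` and is Lipschitz near `y` when read in the chart at `u y`. -/
def LocallyLipschitzAt {Y : Type*} [PseudoEMetricSpace Y] (E : Type*) [NormedAddCommGroup E]
    [NormedSpace ℝ E] {G : Type*} [TopologicalSpace G] [ChartedSpace E G] (u : Y → G) (y : Y) :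
    Prop :=
  ContinuousAt u y ∧ ∃ K : ℝ≥0, ∃ s ∈ 𝓝 y,
    LipschitzOnWith K (fun z => extChartAt 𝓘(ℝ, E) (u y) (u z)) s

variable (E : Type*) [NormedAddCommGroup E] [NormedSpace ℝ E]
  (G : Type*) [TopologicalSpace G] [ChartedSpace E G]
  {P : Ω → Type*} [TopologicalSpace (TotalSpace G P)] [∀ x, TopologicalSpace (P x)]
  [FiberBundle G P]

/-- The section `f` is continuous, as a map into the total space. -/
def IsContinuousSection (f : ∀ x, P x) : Prop :=
  Continuous fun x => (⟨x, f x⟩ : TotalSpace G P)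

/-- The section `g` is locally Lipschitz: it is so in every local trivialization. -/
def IsLocallyLipschitzSection (g : ∀ x, P x) : Prop :=
  ∀ e ∈ FiberBundle.trivializationAtlas G P, ∀ x ∈ e.baseSet,
    LocallyLipschitzAt E (fun z => (e ⟨z, g z⟩).2) x

end Sections

/-! ### The Lie algebra bundle -/

section LieAlgebraBundle

variable {X : Type*} [NormedAddCommGroup X] [NormedSpace ℝ X] {Ω : Opens X}
  (E : Type*) [NormedAddCommGroup E] [NormedSpace ℝ E]
  (G : Type*) [TopologicalSpace G] [ChartedSpace E G] [Group G]
  (Γ : Ω → Type*) [TopologicalSpace (TotalSpace G Γ)] [∀ x, TopologicalSpace (Γ x)]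
  [∀ x, Group (Γ x)] [FiberBundle G Γ]

variable {G Γ} in
/-- The change of trivialization over the point `x`, a map `G → G`. -/
def fiberCoordChange (e e' : Trivialization G (π G Γ)) (x : Ω) (a : G) : G :=
  (e' (e.toOpenPartialHomeomorph.symm (x, a))).2

variable {G Γ} in
/-- The derivative at `1` of the change of trivialization over `x`; here `T₁ G = E`. -/
def lieCoordChange (e e' : Trivialization G (π G Γ)) (x : Ω) : E →L[ℝ] E :=
  mfderiv 𝓘(ℝ, E) 𝓘(ℝ, E) (fiberCoordChange e e' x) (1 : G)

variable {E G Γ}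

set_option linter.unusedSectionVars false in
lemma exists_eq_symm (e : Trivialization G (π G Γ)) {x : Ω} (hx : x ∈ e.baseSet) (a : G) :
    ∃ b : Γ x, e.toOpenPartialHomeomorph.symm (x, a) = ⟨x, b⟩ ∧ e ⟨x, b⟩ = (x, a) := by
  have h1 : (e.toOpenPartialHomeomorph.symm (x, a)).1 = x := e.proj_symm_apply' hx
  have h2 : e (e.toOpenPartialHomeomorph.symm (x, a)) = (x, a) := e.apply_symm_apply' hx
  generalize e.toOpenPartialHomeomorph.symm (x, a) = z at h1 h2
  obtain ⟨y, b⟩ := z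
  obtain rfl : y = x := h1
  exact ⟨b, rfl, h2⟩

lemma fiberCoordChange_self (e : Trivialization G (π G Γ)) {x : Ω} (hx : x ∈ e.baseSet) :
    fiberCoordChange e e x = id := by
  funext a
  obtain ⟨b, hb, hb'⟩ := exists_eq_symm e hx a
  simp [fiberCoordChange, hb, hb']

lemma fiberCoordChange_comp (e e' e'' : Trivialization G (π G Γ)) {x : Ω} (hx : x ∈ e.baseSet)
    (hx' : x ∈ e'.baseSet) :
    fiberCoordChange e' e'' x ∘ fiberCoordChange e e' x = fiberCoordChange e e'' x := by
  funext a
  obtain ⟨b, hb, hb'⟩ := exists_eq_symm e hx a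
  have h : e'.toOpenPartialHomeomorph.symm (x, (e' ⟨x, b⟩).2) = ⟨x, b⟩ := by
    have h1 : (e' (⟨x, b⟩ : TotalSpace G Γ)).1 = x := e'.coe_fst' hx'
    have : (x, (e' ⟨x, b⟩).2) = e' ⟨x, b⟩ := Prod.ext h1.symm rfl
    rw [this]
    exact e'.toOpenPartialHomeomorph.left_inv (e'.mem_source.2 hx')
  simp [fiberCoordChange, hb, h]

variable (E) in
lemma fiberCoordChange_one [IsLieGroupBundle Ω E G 3 Γ] {e e' : Trivialization G (π G Γ)}
    (he : e ∈ FiberBundle.trivializationAtlas G Γ) (he' : e' ∈ FiberBundle.trivializationAtlas G Γ)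
    {x : Ω} (hx : x ∈ e.baseSet) (hx' : x ∈ e'.baseSet) : fiberCoordChange e e' x 1 = 1 := by
  have key : ∀ e ∈ FiberBundle.trivializationAtlas G Γ, x ∈ e.baseSet →
      (e (⟨x, 1⟩ : TotalSpace G Γ)).2 = 1 := fun e he hx => by
    have h := IsLieGroupBundle.map_mul (Ω := Ω) (E := E) (n := 3) e he x hx 1 1
    rw [mul_one] at h
    exact left_eq_mul.1 h
  have h : e.toOpenPartialHomeomorph.symm (x, 1) = (⟨x, 1⟩ : TotalSpace G Γ) := by
    have h1 : (e (⟨x, 1⟩ : TotalSpace G Γ)).1 = x := e.coe_fst' hx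
    have : (x, (1 : G)) = e (⟨x, 1⟩ : TotalSpace G Γ) := Prod.ext h1.symm (key e he hx).symm
    rw [this]
    exact e.toOpenPartialHomeomorph.left_inv (e.mem_source.2 hx)
  simp only [fiberCoordChange, h]
  exact key e' he' hx'

variable [IsLieGroupBundle Ω E G 3 Γ]

lemma contMDiffAt_coordChange {e e' : Trivialization G (π G Γ)}
    (he : e ∈ FiberBundle.trivializationAtlas G Γ) (he' : e' ∈ FiberBundle.trivializationAtlas G Γ)
    {x : Ω} (hx : x ∈ e.baseSet ∩ e'.baseSet) (a : G) :
    ContMDiffAt (𝓘(ℝ, X).prod 𝓘(ℝ, E)) 𝓘(ℝ, E) 3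
      (Function.uncurry (fiberCoordChange e e')) (x, a) :=
  (IsContMDiffFiberBundle.contMDiffOn_coordChange e he e' he' : ContMDiffOn _ _ _ _ _).contMDiffAt
    (((e.open_baseSet.inter e'.open_baseSet).prod isOpen_univ).mem_nhds ⟨hx, mem_univ _⟩)

lemma mdifferentiableAt_fiberCoordChange {e e' : Trivialization G (π G Γ)}
    (he : e ∈ FiberBundle.trivializationAtlas G Γ) (he' : e' ∈ FiberBundle.trivializationAtlas G Γ)
    {x : Ω} (hx : x ∈ e.baseSet ∩ e'.baseSet) (a : G) :
    MDifferentiableAt 𝓘(ℝ, E) 𝓘(ℝ, E) (fiberCoordChange e e' x) a :=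
  ((contMDiffAt_coordChange he he' hx a).comp a
    (contMDiffAt_const.prodMk contMDiffAt_id :
      ContMDiffAt 𝓘(ℝ, E) (𝓘(ℝ, X).prod 𝓘(ℝ, E)) 3 (fun b : G => (x, b)) a)).mdifferentiableAt
    (by norm_num)

variable [LieGroup 𝓘(ℝ, E) 3 G]

lemma continuousOn_lieCoordChange {e e' : Trivialization G (π G Γ)}
    (he : e ∈ FiberBundle.trivializationAtlas G Γ)
    (he' : e' ∈ FiberBundle.trivializationAtlas G Γ) :
    ContinuousOn (lieCoordChange E e e') (e.baseSet ∩ e'.baseSet) := by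
  intro x₀ hx₀
  have : IsManifold 𝓘(ℝ, E) 1 G := IsManifold.of_le (n := 3) (by norm_num)
  have h := ((contMDiffAt_coordChange (E := E) he he' hx₀ 1).mfderiv (m := 0)
    (fiberCoordChange e e') (fun _ => (1 : G)) contMDiffAt_const (by norm_num)).continuousAt
  refine ContinuousAt.continuousWithinAt (h.congr ?_)
  filter_upwards [(e.open_baseSet.inter e'.open_baseSet).mem_nhds hx₀] with x hx
  have h1 := fiberCoordChange_one E he he' hx.1 hx.2
  have h0 := fiberCoordChange_one E he he' hx₀.1 hx₀.2
  have hs : (1 : G) ∈ (tangentBundleCore 𝓘(ℝ, E) G).baseSet (achart E (1 : G)) :=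
    mem_chart_source E (1 : G)
  refine (inTangentCoordinates_eq (I := 𝓘(ℝ, E)) (I' := 𝓘(ℝ, E)) (fun _ => (1 : G))
    (fun x => fiberCoordChange e e' x 1) (lieCoordChange E e e') (x₀ := x₀) (x := x) hs
    (by rw [h1, h0]; exact hs)).trans ?_
  ext v
  simp only [ContinuousLinearMap.comp_apply, h1, h0]
  rw [(tangentBundleCore 𝓘(ℝ, E) G).coordChange_self _ _ hs,
    (tangentBundleCore 𝓘(ℝ, E) G).coordChange_self _ _ hs]

variable (E G Γ)

/-- The Lie algebra bundle `Γ̇ → Ω` of the Lie group bundle `Γ`: its fibre `Γ̇ x = T₁ (Γ x)` is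
identified with `T₁ G = E` by a trivialization of `Γ`, and its coordinate changes are the
derivatives at `1` of those of `Γ`. As usual for vector bundle cores, the type of `Γ̇ x` is `E`,
with `v : E` standing for the tangent vector whose coordinate in the preferred
trivialization of `Γ` at `x` is `v`. -/
def lieAlgebraBundle : VectorBundleCore ℝ Ω E (FiberBundle.trivializationAtlas G Γ) where
  baseSet e := e.1.baseSet
  isOpen_baseSet e := e.1.open_baseSet
  indexAt x := ⟨FiberBundle.trivializationAt G Γ x, FiberBundle.trivialization_mem_atlas G Γ x⟩
  mem_baseSet_at x := FiberBundle.mem_baseSet_trivializationAt G Γ x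
  coordChange e e' x := lieCoordChange E e.1 e'.1 x
  coordChange_self e x hx v := by
    have h : lieCoordChange E e.1 e.1 x = ContinuousLinearMap.id ℝ E := by
      unfold lieCoordChange
      rw [fiberCoordChange_self e.1 hx]
      exact mfderiv_id
    rw [h]
    rfl
  continuousOn_coordChange e e' := continuousOn_lieCoordChange e.2 e'.2
  coordChange_comp e e' e'' x hx v := by
    have h := (mdifferentiableAt_fiberCoordChange (E := E) e.2 e'.2 hx.1 1).hasMFDerivAt
    have h' := (mdifferentiableAt_fiberCoordChange (E := E) e'.2 e''.2 ⟨hx.1.2, hx.2⟩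
      (fiberCoordChange e.1 e'.1 x 1)).hasMFDerivAt
    have h'' := (h'.comp (1 : G) h).mfderiv
    rw [fiberCoordChange_comp _ _ _ hx.1.1 hx.1.2] at h''
    simp only [lieCoordChange]
    rw [h'', fiberCoordChange_one E e.2 e'.2 hx.1.1 hx.1.2]
    rfl

/-- The fibre `Γ̇ x`. -/
abbrev LieFiber (x : Ω) : Type _ := (lieAlgebraBundle E G Γ).Fiber x

/-! ### Exponential map, normal neighbourhoods, logarithm -/

variable {E G} in
/-- The exponential map of the Lie group `G`: `exp v = γ 1`, where `γ` is the integral curve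
with `γ 0 = 1` of the left invariant vector field given by `v`. -/
def lieExp (v : GroupLieAlgebra 𝓘(ℝ, E) G) : G :=
  Classical.epsilon fun a => ∃ γ : ℝ → G, γ 0 = 1 ∧
    IsMIntegralCurve γ (mulInvariantVectorField v) ∧ γ 1 = a

/-- The exponential map `exp_x : Γ̇ x → Γ x`, obtained from that of `G` through the preferred
trivialization of `Γ` at `x`, a group isomorphism `Γ x ≃ G`. -/
def fiberExp (x : Ω) (v : LieFiber E G Γ x) : Γ x :=
  Function.invFun (fun a : Γ x => (FiberBundle.trivializationAt G Γ x ⟨x, a⟩).2)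
    (lieExp (E := E) (G := G) v)

/-- The exponential map as a map `Γ̇ → Γ` of total spaces. -/
def bundleExp (v : TotalSpace E (LieFiber E G Γ)) : TotalSpace G Γ :=
  ⟨v.1, fiberExp E G Γ v.1 v.2⟩

/-- A normal neighbourhood (of the zero section): an open neighbourhood of the zero section of
`Γ̇` that the exponential map sends homeomorphically onto an open subset of `Γ`. -/
structure IsNormalNeighborhood (N : Set (TotalSpace E (LieFiber E G Γ))) : Prop where
  isOpen : IsOpen N
  zero_mem : ∀ x : Ω, (⟨x, 0⟩ : TotalSpace E (LieFiber E G Γ)) ∈ N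
  isOpenEmbedding : IsOpenEmbedding (N.domRestrict (bundleExp E G Γ))

variable {E G Γ}

/-- The part `N x` of the normal neighbourhood `N` in the fibre `Γ̇ x`. -/
def fiberPart (N : Set (TotalSpace E (LieFiber E G Γ))) (x : Ω) : Set (LieFiber E G Γ x) :=
  {v | (⟨x, v⟩ : TotalSpace E (LieFiber E G Γ)) ∈ N}

/-- The logarithm `log_x`, inverse of `exp_x : N x → exp_x (N x)`, for a normal neighbourhood
`N`. -/
def fiberLog (N : Set (TotalSpace E (LieFiber E G Γ))) (x : Ω) (a : Γ x) : LieFiber E G Γ x :=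
  Function.invFunOn (fiberExp E G Γ x) (fiberPart N x) a

variable (E G Γ)

/-- A continuous norm on the Lie algebra bundle: a norm on each fibre `Γ̇ x`, continuous as a
function on the total space. -/
structure ContinuousNorm where
  toFun : ∀ x : Ω, Seminorm ℝ (LieFiber E G Γ x)
  eq_zero : ∀ (x : Ω) (v : LieFiber E G Γ x), toFun x v = 0 → v = 0
  continuous : Continuous fun v : TotalSpace E (LieFiber E G Γ) => toFun v.1 v.2

end LieAlgebraBundle

end

/-! The core is a statement about fibre bundles with locally Lipschitz changes of charts over a
separable metric space: every open neighbourhood `W` of the image of a continuous section contains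
the image of a locally Lipschitz section (`IsLipschitzAtlas.exists_lipschitz_section`). Fibres are
not linear, so averaging is possible only inside one chart. There a partition of unity gives a
Lipschitz approximation, which a cutoff interpolates with the old section
(`IsLipschitzAtlas.exists_step`). By separability countably many charts suffice, and the
corrections, made one after another, are locally finite.

For a principal bundle take `W = {p | f⁻¹ p ∈ exp N'}`, where `N' ⊆ N` is an open neighbourhood of
the zero section. It is open because `exp` is open on `N`, and it contains `f` because `exp 0 = 1`.
The choice `N' = N ∩ {|v| < ε}` gives the approximation. If `N` is fibrewise star-shaped, then `v =
log (f⁻¹ g)` is continuous and `f · exp (t v)` is the homotopy.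

Normal neighbourhoods come from `G`. In the chart at `1`, one-parameter groups solve `c' = A c v`
with `A` Lipschitz near the base point and equal to the identity there. The time one map is strictly
differentiable at `0` with derivative the identity, so the inverse function theorem makes `exp` a
homeomorphism on a ball (`exists_openPartialHomeomorph_lieExp`). Naturality of `exp` under
coordinate changes and paracompactness of `Ω` carry this over to the bundle
(`exists_isNormalNeighborhood`). -/

/-! ### Locally Lipschitz maps, partitions of unity and approximation -/

section LocallyLipschitz

/-- `u` is Lipschitz on a neighbourhood of `y`. -/
def LipAt {Y F : Type*} [PseudoEMetricSpace Y] [PseudoEMetricSpace F] (u : Y → F) (y : Y) : Prop :=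
  ∃ K : ℝ≥0, ∃ s ∈ 𝓝 y, LipschitzOnWith K u s

namespace LipAt

variable {Y Z F : Type*} [PseudoEMetricSpace Y] [PseudoEMetricSpace Z] [PseudoEMetricSpace F]

lemma continuousAt {u : Y → Z} {y : Y} (hu : LipAt u y) : ContinuousAt u y := by
  obtain ⟨K, s, hs, h⟩ := hu
  exact h.continuousOn.continuousAt hs

lemma congr {u v : Y → Z} {y : Y} (hu : LipAt u y) (h : v =ᶠ[𝓝 y] u) : LipAt v y := by
  obtain ⟨K, s, hs, hK⟩ := hu
  refine ⟨K, s ∩ {x | v x = u x}, inter_mem hs h, fun a ha b hb => ?_⟩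
  rw [show v a = u a from ha.2, show v b = u b from hb.2]
  exact hK ha.1 hb.1

lemma comp {f : Z → F} {u : Y → Z} {y : Y} (hf : LipAt f (u y)) (hu : LipAt u y) :
    LipAt (fun x => f (u x)) y := by
  have hc := hu.continuousAt
  obtain ⟨K, s, hs, hK⟩ := hu
  obtain ⟨L, t, ht, hL⟩ := hf
  exact ⟨L * K, s ∩ u ⁻¹' t, inter_mem hs (hc ht),
    hL.comp (hK.mono inter_subset_left) ((mapsTo_preimage u t).mono_left inter_subset_right)⟩

lemma prodMk {f : Y → Z} {g : Y → F} {y : Y} (hf : LipAt f y) (hg : LipAt g y) :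
    LipAt (fun x => (f x, g x)) y := by
  obtain ⟨K, s, hs, hK⟩ := hf
  obtain ⟨L, t, ht, hL⟩ := hg
  exact ⟨max K L, s ∩ t, inter_mem hs ht,
    (hK.mono inter_subset_left).prodMk (hL.mono inter_subset_right)⟩

lemma id {y : Y} : LipAt (fun x : Y => x) y :=
  LocallyLipschitz.id y

lemma const {y : Y} (c : F) : LipAt (fun _ : Y => c) y :=
  LocallyLipschitz.const c y

end LipAt

lemma ContDiffAt.lipAt {E F : Type*} [NormedAddCommGroup E] [NormedSpace ℝ E]
    [NormedAddCommGroup F] [NormedSpace ℝ F] {f : E → F} {x : E} (hf : ContDiffAt ℝ 1 f x) :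
    LipAt f x := by
  obtain ⟨K, s, hs, h⟩ := hf.exists_lipschitzOnWith
  exact ⟨K, s, hs, h⟩

namespace LipAt

variable {Y E : Type*} [PseudoEMetricSpace Y] [NormedAddCommGroup E] [NormedSpace ℝ E]

lemma smul {a : Y → ℝ} {u : Y → E} {y : Y} (ha : LipAt a y) (hu : LipAt u y) :
    LipAt (fun x => a x • u x) y :=
  (show LipAt (fun p : ℝ × E => p.1 • p.2) (a y, u y) from
    (contDiffAt_fst.smul contDiffAt_snd).lipAt).comp (u := fun x => (a x, u x)) (ha.prodMk hu)

lemma add {u v : Y → E} {y : Y} (hu : LipAt u y) (hv : LipAt v y) :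
    LipAt (fun x => u x + v x) y :=
  (show LipAt (fun p : E × E => p.1 + p.2) (u y, v y) from
    (contDiffAt_fst.add contDiffAt_snd).lipAt).comp (u := fun x => (u x, v x)) (hu.prodMk hv)

lemma sum {ι : Type*} {u : ι → Y → E} {y : Y} (t : Finset ι) (h : ∀ i ∈ t, LipAt (u i) y) :
    LipAt (fun x => ∑ i ∈ t, u i x) y := by
  classical
  induction t using Finset.induction_on with
  | empty => simpa using const (y := y) (0 : E)
  | insert i t hi ih =>
    simp only [Finset.sum_insert hi]
    exact (h i (by simp)).add (ih fun j hj => h j (by simp [hj]))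

lemma one_sub {a : Y → ℝ} {y : Y} (ha : LipAt a y) : LipAt (fun x => 1 - a x) y :=
  (show LipAt (fun p : ℝ => 1 - p) (a y) from (contDiffAt_const.sub contDiffAt_id).lipAt).comp ha

lemma prod {ι : Type*} {a : ι → Y → ℝ} {y : Y} (t : Finset ι) (h : ∀ i ∈ t, LipAt (a i) y) :
    LipAt (fun x => ∏ i ∈ t, a i x) y := by
  classical
  induction t using Finset.induction_on with
  | empty => simpa using const (y := y) (1 : ℝ)
  | insert i t hi ih =>
    simp only [Finset.prod_insert hi]
    exact (h i (by simp)).smul (ih fun j hj => h j (by simp [hj]))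

end LipAt

/-- Urysohn's lemma with locally Lipschitz functions. -/
lemma exists_lipAt_zero_one {Y : Type*} [PseudoMetricSpace Y] {s t : Set Y} (hs : IsClosed s)
    (ht : IsClosed t) (hd : Disjoint s t) :
    ∃ f : C(Y, ℝ), (∀ y, LipAt f y) ∧ EqOn f 0 s ∧ EqOn f 1 t ∧ ∀ x, f x ∈ Icc (0 : ℝ) 1 := by
  -- `Metric.infDist` to the empty set is `0` by convention, so the quotient of distances used below
  -- needs both sets nonempty.
  rcases s.eq_empty_or_nonempty with rfl | hsn
  · exact ⟨1, fun y => LipAt.const (1 : ℝ), by simp, fun _ _ => rfl, fun x => by simp⟩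
  rcases t.eq_empty_or_nonempty with rfl | htn
  · exact ⟨0, fun y => LipAt.const (0 : ℝ), fun _ _ => rfl, by simp, fun x => by simp⟩
  have hpos : ∀ x, 0 < Metric.infDist x s + Metric.infDist x t := fun x => by
    by_contra! h
    have h1 := Metric.infDist_nonneg (x := x) (s := s)
    have h2 := Metric.infDist_nonneg (x := x) (s := t)
    exact disjoint_left.1 hd ((hs.mem_iff_infDist_zero hsn).2 (by linarith))
      ((ht.mem_iff_infDist_zero htn).2 (by linarith))
  have hlip : ∀ y, LipAt (fun x => Metric.infDist x s / (Metric.infDist x s + Metric.infDist x t))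
      y := fun y => by
    have h : LipAt (fun p : ℝ × ℝ => p.1 / (p.1 + p.2)) (Metric.infDist y s, Metric.infDist y t) :=
      (contDiffAt_fst.div (contDiffAt_fst.add contDiffAt_snd) (hpos y).ne').lipAt
    exact h.comp (u := fun x => (Metric.infDist x s, Metric.infDist x t))
      (LipAt.prodMk ((Metric.lipschitz_infDist_pt s).locallyLipschitz y)
        ((Metric.lipschitz_infDist_pt t).locallyLipschitz y))
  refine ⟨⟨_, continuous_iff_continuousAt.2 fun y => (hlip y).continuousAt⟩, hlip,
    fun x hx => ?_, fun x hx => ?_, fun x => ?_⟩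
  · simp [(hs.mem_iff_infDist_zero hsn).1 hx]
  · have h := hpos x
    have h0 := (ht.mem_iff_infDist_zero htn).1 hx
    simp only [h0, add_zero] at h
    simp [h0, h.ne']
  · exact ⟨div_nonneg Metric.infDist_nonneg (hpos x).le,
      (div_le_one (hpos x)).2 (le_add_of_nonneg_right Metric.infDist_nonneg)⟩

/-- Convex-valued maps on a metric space that have local constant selections have locally Lipschitz
selections. -/
lemma exists_lipAt_forall_mem_convex {Y E : Type*} [MetricSpace Y] [NormedAddCommGroup E]
    [NormedSpace ℝ E] {t : Y → Set E} (ht : ∀ x, Convex ℝ (t x))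
    (H : ∀ x, ∃ c : E, ∀ᶠ y in 𝓝 x, c ∈ t y) :
    ∃ w : Y → E, (∀ y, LipAt w y) ∧ ∀ x, w x ∈ t x := by
  choose c hc using H
  -- The partition of unity attached to a bump covering consists of products `f i * ∏ (1 - f j)`
  -- over `j` before `i`. Locally these are finite products, so they inherit the Lipschitz property
  -- of the bumps.
  obtain ⟨b, hb, hbU⟩ := BumpCovering.exists_isSubordinate_of_prop (s := (univ : Set Y))
    (fun f => ∀ y, LipAt f y) (fun s t hs ht hd => exists_lipAt_zero_one hs ht hd) isClosed_univ
    (fun x => interior {y | c x ∈ t y}) (fun x => isOpen_interior)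
    fun x _ => mem_iUnion.2 ⟨x, mem_interior_iff_mem_nhds.2 (hc x)⟩
  have hρ : ∀ i y, LipAt (b.toPartitionOfUnity i) y := fun i y => by
    classical
    obtain ⟨u, hu⟩ := b.exists_finset_toPartitionOfUnity_eventuallyEq i y
    refine LipAt.congr ?_ hu
    refine LipAt.congr (((hb i y).smul
      (LipAt.prod (u.filter fun j => WellOrderingRel j i) fun j _ => (hb j y).one_sub)))
      (Eventually.of_forall fun x => ?_)
    simp
  refine ⟨fun x => ∑ᶠ i, b.toPartitionOfUnity i x • c i, fun y => ?_, fun x =>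
    b.toPartitionOfUnity.finsum_smul_mem_convex (g := fun i _ => c i) (mem_univ x)
      (fun i hi => ?_) (ht x)⟩
  · obtain ⟨U, hU, hfin⟩ := b.toPartitionOfUnity.locallyFinite y
    refine LipAt.congr (LipAt.sum hfin.toFinset fun i _ => (hρ i y).smul (LipAt.const (c i))) ?_
    filter_upwards [hU] with x hx
    refine finsum_eq_sum_of_support_subset _ fun i hi => ?_
    simp only [Finite.coe_toFinset, mem_ofPred_eq]
    refine ⟨x, fun h => hi ?_, hx⟩
    simp [h]
  · have h := hbU.toPartitionOfUnity i (subset_tsupport _ hi)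
    exact (interior_subset h : x ∈ {y | c i ∈ t y})

/-- A map `u`, continuous along the closed set `C`, whose graph over `C` lies in the open set `D`,
can be approximated along `C` by a locally Lipschitz map, with fibrewise balls in `D` as errors. -/
lemma exists_lipAt_near {Y E : Type*} [MetricSpace Y] [NormedAddCommGroup E]
    [NormedSpace ℝ E] {C : Set Y} (hC : IsClosed C) {u : Y → E} (hu : ∀ x ∈ C, ContinuousAt u x)
    {D : Set (Y × E)} (hD : IsOpen D) (hCD : ∀ x ∈ C, (x, u x) ∈ D) :
    ∃ w : Y → E, (∀ y, LipAt w y) ∧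
      ∀ x ∈ C, ∃ r, w x ∈ Metric.ball (u x) r ∧ ∀ d ∈ Metric.ball (u x) r, (x, d) ∈ D := by
  -- The fibre of `D` need not be convex, but the union of the balls centred at `u x` that lie in it
  -- is: of two concentric balls one contains the other.
  refine exists_lipAt_forall_mem_convex (t := fun x => {c | x ∈ C → ∃ r, c ∈ Metric.ball (u x) r ∧
    ∀ d ∈ Metric.ball (u x) r, (x, d) ∈ D}) (fun x => ?_) (fun x => ?_)
  · by_cases hx : x ∈ C
    · intro a ha b hb p q hp hq hpq _
      obtain ⟨r, har, hr⟩ := ha hx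
      obtain ⟨r', hbr, hr'⟩ := hb hx
      rcases le_total r r' with h | h
      · exact ⟨r', convex_ball _ _ (Metric.ball_subset_ball h har) hbr hp hq hpq, hr'⟩
      · exact ⟨r, convex_ball _ _ har (Metric.ball_subset_ball h hbr) hp hq hpq, hr⟩
    · intro a _ b _ p q _ _ _ h
      exact absurd h hx
  · by_cases hx : x ∈ C
    · obtain ⟨ρ, hρ, hball⟩ := Metric.isOpen_iff.1 hD _ (hCD x hx)
      -- The constant `u x` is a local selection. For `y` near `x` the ball of radius `ρ / 2` about
      -- `u y` contains `u x`, and it stays in the `ρ`-ball about `u x`.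
      refine ⟨u x, ?_⟩
      filter_upwards [(hu x hx) (Metric.ball_mem_nhds (u x) (half_pos hρ)),
        Metric.ball_mem_nhds x hρ] with y hy hyx _
      refine ⟨ρ / 2, by simpa [dist_comm] using hy, fun d hd => hball ?_⟩
      rw [← ball_prod_same]
      refine ⟨hyx, ?_⟩
      have h1 : dist (u y) (u x) < ρ / 2 := hy
      have h2 : dist d (u y) < ρ / 2 := hd
      exact (dist_triangle _ _ _).trans_lt (by linarith)
    · exact ⟨0, by filter_upwards [hC.isOpen_compl.mem_nhds hx] with y hy h using absurd h hy⟩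

end LocallyLipschitz

/-! ### Locally Lipschitz sections of Lipschitz fibre bundles -/

section LipschitzSections

variable {Y Z E ι : Type*} [MetricSpace Y] [TopologicalSpace Z] [NormedAddCommGroup E]

/-- A family of charts of `Z` with values in `Y × E`, over the projection `pr : Z → Y`, covering `Z`,
with locally Lipschitz changes of charts. -/
structure IsLipschitzAtlas (pr : Z → Y) (Φ : ι → OpenPartialHomeomorph Z (Y × E)) : Prop where
  continuous_proj : Continuous pr
  fst_eq : ∀ i, ∀ z ∈ (Φ i).source, (Φ i z).1 = pr z
  cover : ∀ z, ∃ i, z ∈ (Φ i).source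
  lipAt_change : ∀ i j, ∀ z ∈ (Φ i).source, z ∈ (Φ j).source →
    LipAt (fun q => (Φ j ((Φ i).symm q)).2) (Φ i z)

namespace IsLipschitzAtlas

variable {pr : Z → Y} {Φ : ι → OpenPartialHomeomorph Z (Y × E)}

/-- Being locally Lipschitz at a point can be checked in one chart. -/
lemma lipAt_of_lipAt (h : IsLipschitzAtlas pr Φ) {s : Y → Z} (hs : ∀ x, pr (s x) = x) {y : Y}
    (hc : ContinuousAt s y) {i j : ι} (hi : s y ∈ (Φ i).source) (hj : s y ∈ (Φ j).source)
    (hl : LipAt (fun x => (Φ i (s x)).2) y) : LipAt (fun x => (Φ j (s x)).2) y := by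
  have hy : Φ i (s y) = (y, (Φ i (s y)).2) :=
    Prod.ext ((h.fst_eq i _ hi).trans (hs y)) rfl
  have h1 := h.lipAt_change i j _ hi hj
  rw [hy] at h1
  refine (h1.comp (u := fun x => (x, (Φ i (s x)).2)) (LipAt.id.prodMk hl)).congr ?_
  filter_upwards [hc ((Φ i).open_source.mem_nhds hi)] with x hx
  have hx' : (x, (Φ i (s x)).2) = Φ i (s x) :=
    Prod.ext ((h.fst_eq i _ hx).trans (hs x)).symm rfl
  rw [hx', (Φ i).left_inv hx]

variable [NormedSpace ℝ E]

/-- A continuous section can be modified inside an open set, in one chart, so as to become locally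
Lipschitz on a given smaller set, without leaving a given open set and without losing the locally
Lipschitz property where it holds. -/
lemma exists_step (h : IsLipschitzAtlas pr Φ) {W : Set Z} (hW : IsOpen W) {s : Y → Z}
    (hs : ∀ x, pr (s x) = x) (hc : Continuous s) (hsW : ∀ x, s x ∈ W) (i : ι) {T V O : Set Y}
    (hO : IsOpen O) (hV : IsOpen V) (hTV : closure T ⊆ V) (hVO : closure V ⊆ O)
    (hT : IsOpen T) (hOi : ∀ x ∈ closure O, s x ∈ (Φ i).source) :
    ∃ s' : Y → Z, (∀ x, pr (s' x) = x) ∧ Continuous s' ∧ (∀ x, s' x ∈ W) ∧ (∀ x ∉ O, s' x = s x) ∧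
      ∀ y, (y ∈ T ∨ ∀ j, s y ∈ (Φ j).source → LipAt (fun x => (Φ j (s x)).2) y) →
        ∀ j, s' y ∈ (Φ j).source → LipAt (fun x => (Φ j (s' x)).2) y := by
  classical
  have hfst : ∀ x ∈ closure O, Φ i (s x) = (x, (Φ i (s x)).2) := fun x hx =>
    Prod.ext ((h.fst_eq i _ (hOi x hx)).trans (hs x)) rfl
  have hcu : ∀ x ∈ closure O, ContinuousAt (fun x => (Φ i (s x)).2) x := fun x hx =>
    continuous_snd.continuousAt.comp
      (((Φ i).continuousAt (hOi x hx)).comp (f := s) hc.continuousAt)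
  obtain ⟨w, hw, hwD⟩ := exists_lipAt_near (C := closure O) isClosed_closure
    (u := fun x => (Φ i (s x)).2) hcu ((Φ i).isOpen_inter_preimage_symm hW) (fun x hx => by
      rw [← hfst x hx]
      exact ⟨(Φ i).map_source (hOi x hx), by
        simpa [(Φ i).left_inv (hOi x hx)] using hsW x⟩)
  have hdisj : Disjoint Vᶜ (closure T) := disjoint_compl_left_iff_subset.2 hTV
  obtain ⟨χ, hχ, hχ0, hχ1, hχI⟩ := exists_lipAt_zero_one hV.isClosed_compl isClosed_closure hdisj
  -- The interpolation equals `w` on `T` and the old section off `V`. It stays in `W` because `w x`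
  -- lies in an admissible ball centred at the old value.
  let v : Y → E := fun x => (1 - χ x) • (Φ i (s x)).2 + χ x • w x
  have hvD : ∀ x ∈ closure O, (x, v x) ∈ (Φ i).target ∩ (Φ i).symm ⁻¹' W := fun x hx => by
    obtain ⟨r, hwr, hr⟩ := hwD x hx
    have hr0 : 0 < r := Metric.pos_of_mem_ball hwr
    exact hr _ (convex_ball _ _ (Metric.mem_ball_self hr0) hwr (sub_nonneg.2 (hχI x).2)
      (hχI x).1 (by ring))
  have hcv : ∀ x ∈ closure O, ContinuousAt v x := fun x hx =>
    ((continuousAt_const.sub χ.continuous.continuousAt).smul (hcu x hx)).add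
      (χ.continuous.continuousAt.smul (hw x).continuousAt)
  let s' : Y → Z := fun x => if x ∈ O then (Φ i).symm (x, v x) else s x
  have hOc := subset_closure (s := O)
  have hout : ∀ x ∉ V, s' x = s x := fun x hx => by
    by_cases hxO : x ∈ O
    · have h0 : χ x = 0 := hχ0 hx
      have hv : v x = (Φ i (s x)).2 := by simp [v, h0]
      simp only [s', if_pos hxO, hv]
      rw [← hfst x (hOc hxO), (Φ i).left_inv (hOi x (hOc hxO))]
    · simp [s', hxO]
  have hproj : ∀ x ∈ O, Φ i (s' x) = (x, v x) := fun x hx => by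
    simp only [s', if_pos hx]
    exact (Φ i).right_inv (hvD x (hOc hx)).1
  have hsrc : ∀ x ∈ O, s' x ∈ (Φ i).source := fun x hx => by
    simp only [s', if_pos hx]
    exact (Φ i).map_target (hvD x (hOc hx)).1
  -- The gap between `closure V` and the complement of `O` makes the two branches of `s'` agree near
  -- the boundary of `O`.
  have hev : ∀ x ∉ O, s' =ᶠ[𝓝 x] s := fun x hx => by
    filter_upwards [isClosed_closure.isOpen_compl.mem_nhds fun h => hx (hVO h)] with y hy
    exact hout y fun h => hy (subset_closure h)
  have hcont : Continuous s' := continuous_iff_continuousAt.2 fun x => by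
    by_cases hx : x ∈ O
    · have h1 : ContinuousAt (fun x => (Φ i).symm (x, v x)) x :=
        ((Φ i).continuousAt_symm (hvD x (hOc hx)).1).comp (f := fun x => (x, v x))
          (continuousAt_id.prodMk (hcv x (hOc hx)))
      refine h1.congr ?_
      filter_upwards [hO.mem_nhds hx] with y hy
      simp [s', hy]
    · exact hc.continuousAt.congr (hev x hx).symm
  have hsec : ∀ x, pr (s' x) = x := fun x => by
    by_cases hx : x ∈ O
    · rw [← h.fst_eq i _ (hsrc x hx), hproj x hx]
    · simp [s', hx, hs]
  refine ⟨s', hsec, hcont, fun x => ?_, fun x hx => if_neg hx, fun y hy j hj => ?_⟩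
  · by_cases hx : x ∈ O
    · simp only [s', if_pos hx]
      exact (hvD x (hOc hx)).2
    · simp [s', hx, hsW]
  · by_cases hyO : y ∈ O
    · have hvy : LipAt v y := by
        rcases hy with hy | hy
        · refine (hw y).congr ?_
          filter_upwards [hT.mem_nhds hy] with x hx
          have h1 : χ x = 1 := hχ1 (subset_closure hx)
          simp [v, h1]
        · exact ((hχ y).one_sub.smul (hy i (hOi y (hOc hyO)))).add ((hχ y).smul (hw y))
      refine h.lipAt_of_lipAt hsec hcont.continuousAt (hsrc y hyO) hj (hvy.congr ?_)
      filter_upwards [hO.mem_nhds hyO] with x hx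
      rw [hproj x hx]
    · have hyT : y ∉ T := fun h => hyO (hVO (subset_closure (hTV (subset_closure h))))
      have h1 := hev y hyO
      rw [h1.eq_of_nhds] at hj
      refine ((hy.resolve_left hyT) j hj).congr ?_
      filter_upwards [h1] with x hx
      rw [hx]

/-- In a Lipschitz fibre bundle over a separable metric space, every open neighbourhood of the
image of a continuous section contains the image of a locally Lipschitz section. -/
theorem exists_lipschitz_section [SecondCountableTopology Y] (h : IsLipschitzAtlas pr Φ) {W : Set Z}
    (hW : IsOpen W) {s : Y → Z} (hs : ∀ x, pr (s x) = x) (hc : Continuous s) (hsW : ∀ x, s x ∈ W) :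
    ∃ s' : Y → Z, (∀ x, pr (s' x) = x) ∧ Continuous s' ∧ (∀ x, s' x ∈ W) ∧
      ∀ y j, s' y ∈ (Φ j).source → LipAt (fun x => (Φ j (s' x)).2) y := by
  rcases isEmpty_or_nonempty Y with hY | hY
  · exact ⟨s, hs, hc, hsW, fun y => isEmptyElim y⟩
  choose i₀ hi₀ using fun y => h.cover (s y)
  -- Lindelöf: with countably many charts the corrections can be performed in a sequence.
  obtain ⟨S, hS, hSU⟩ := countable_cover_nhds (f := fun y => s ⁻¹' (Φ (i₀ y)).source)
    fun y => hc.continuousAt ((Φ (i₀ y)).open_source.mem_nhds (hi₀ y))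
  have hSn : S.Nonempty := by
    rw [nonempty_iff_ne_empty]
    rintro rfl
    simp only [mem_empty_iff_false, iUnion_of_empty, iUnion_empty] at hSU
    exact (empty_ne_univ hSU)
  obtain ⟨e, rfl⟩ := hS.exists_eq_range hSn
  simp only [mem_range, iUnion_exists, iUnion_iUnion_eq'] at hSU
  let i : ℕ → ι := fun n => i₀ (e n)
  obtain ⟨U, hUo, hUc, hUf, hU⟩ := precise_refinement (fun n => s ⁻¹' (Φ (i n)).source)
    (fun n => (Φ (i n)).open_source.preimage hc) hSU
  obtain ⟨O, hOc, hOo, hOU⟩ := exists_iUnion_eq_closure_subset hUo hUf.point_finite hUc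
  have hOf : LocallyFinite fun n => closure (O n) := hUf.subset hOU
  have hOf' : LocallyFinite O := hOf.subset fun n => subset_closure
  obtain ⟨V, hVc, hVo, hVO⟩ := exists_iUnion_eq_closure_subset hOo hOf'.point_finite hOc
  obtain ⟨T, hTc, hTo, hTV⟩ := exists_iUnion_eq_closure_subset hVo
    (hOf'.subset fun n => subset_closure.trans (hVO n)).point_finite hVc
  -- Corrected sections must remain visible in all the charts still to be used. `W'` demands this
  -- over every `closure (O n)`, and it is open because these closed sets are locally finite.
  let W' : Set Z := W ∩ (⋃ n, pr ⁻¹' closure (O n) ∩ (Φ (i n)).sourceᶜ)ᶜ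
  have hW' : IsOpen W' := hW.inter <| IsClosed.isOpen_compl (self :=
    LocallyFinite.isClosed_iUnion ((hOf.preimage_continuous h.continuous_proj).subset
      fun n => inter_subset_left) fun n => (isClosed_closure.preimage h.continuous_proj).inter
        (Φ (i n)).open_source.isClosed_compl)
  have hW'i : ∀ z ∈ W', ∀ n, pr z ∈ closure (O n) → z ∈ (Φ (i n)).source := fun z hz n hzn => by
    by_contra hcon
    exact hz.2 (mem_iUnion.2 ⟨n, hzn, hcon⟩)
  let Q : ℕ → (Y → Z) → Prop := fun n s => (∀ x, pr (s x) = x) ∧ Continuous s ∧ (∀ x, s x ∈ W') ∧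
    ∀ k < n, ∀ y ∈ T k, ∀ j, s y ∈ (Φ j).source → LipAt (fun x => (Φ j (s x)).2) y
  have hQ0 : Q 0 s := ⟨hs, hc, fun x => ⟨hsW x, fun hx => by
    obtain ⟨n, hn, hn'⟩ := mem_iUnion.1 hx
    rw [mem_preimage, hs] at hn
    exact hn' (hU n (hOU n hn))⟩, fun k hk => absurd hk (Nat.not_lt_zero k)⟩
  have hQs : ∀ n (s : Y → Z), Q n s → ∃ s', Q (n + 1) s' ∧ ∀ x ∉ O n, s' x = s x := by
    rintro n s ⟨hs, hc, hsW, hl⟩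
    obtain ⟨s', h1, h2, h3, h4, h5⟩ := h.exists_step hW' hs hc hsW (i n) (hOo n) (hVo n) (hTV n)
      (hVO n) (hTo n) fun x hx => hW'i _ (hsW x) n (by rwa [hs])
    refine ⟨s', ⟨h1, h2, h3, fun k hk y hy => h5 y ?_⟩, h4⟩
    rcases Nat.lt_succ_iff_lt_or_eq.1 hk with hk | rfl
    · exact Or.inr (hl k hk y hy)
    · exact Or.inl hy
  choose! next hnext hnext' using hQs
  let σ : ℕ → Y → Z := fun n => Nat.rec s (fun n s => next n s) n
  have hσ : ∀ n, Q n (σ n) := fun n => by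
    induction n with
    | zero => exact hQ0
    | succ n ih => exact hnext n _ ih
  -- Stage `n` alters the section only over `O n`, so near each point the sequence is eventually
  -- constant and its limit inherits every local property.
  have hσf : LocallyFinite fun n => {x | σ (n + 1) x ≠ σ n x} := hOf'.subset fun n x hx => by
    by_contra hxO
    exact hx (hnext' n _ (hσ n) x hxO)
  obtain ⟨F, hF⟩ := hσf.exists_forall_eventually_atTop_eventuallyEq
  refine ⟨F, fun x => ?_, continuous_iff_continuousAt.2 fun x => ?_, fun x => ?_, fun y j hj => ?_⟩
  · obtain ⟨n, hn⟩ := (hF x).exists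
    rw [← hn.eq_of_nhds]
    exact (hσ n).1 x
  · obtain ⟨n, hn⟩ := (hF x).exists
    exact (hσ n).2.1.continuousAt.congr hn
  · obtain ⟨n, hn⟩ := (hF x).exists
    rw [← hn.eq_of_nhds]
    exact ((hσ n).2.2.1 x).1
  · obtain ⟨k, hk⟩ := mem_iUnion.1 (hTc.symm ▸ mem_univ y : y ∈ ⋃ n, T n)
    obtain ⟨n, hn, hkn⟩ := ((hF y).and (eventually_gt_atTop k)).exists
    rw [← hn.eq_of_nhds] at hj
    refine ((hσ n).2.2.2 k hkn y hk j hj).congr ?_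
    filter_upwards [hn] with x hx
    rw [hx]

end IsLipschitzAtlas

end LipschitzSections

/-! ### Dependence of integral curves on a parameter -/

section ParametrizedFlow

variable {E : Type*} [NormedAddCommGroup E] [NormedSpace ℝ E]

/-- Picard–Lindelöf with uniform constants: `K * ρ ≤ 1` gives `‖A‖ ≤ 2` on the ball, so the speed is
at most `2 * ‖v‖` and for `|t| ≤ 2` the curve moves by at most `4 * ‖v‖ < ρ`. The time interval is
chosen to have `1` in its interior. -/
lemma exists_integralCurve_of_lipschitzOnWith [CompleteSpace E] {A : E → E →L[ℝ] E} {y₀ : E}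
    {K : ℝ≥0} {ρ : ℝ} (hK : LipschitzOnWith K A (Metric.ball y₀ ρ)) (hρ : 0 < ρ)
    (h0 : A y₀ = ContinuousLinearMap.id ℝ E) (hKρ : K * ρ ≤ 1) {v : E} (hv : 4 * ‖v‖ < ρ) :
    ∃ c : ℝ → E, c 0 = y₀ ∧ ∀ t ∈ Ioo (-2 : ℝ) 2,
      HasDerivAt c (A (c t) v) t ∧ c t ∈ Metric.closedBall y₀ (4 * ‖v‖) := by
  have hsub : Metric.closedBall y₀ (4 * ‖v‖) ⊆ Metric.ball y₀ ρ := fun y hy =>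
    lt_of_le_of_lt (Metric.mem_closedBall.1 hy) hv
  have hA2 : ∀ y ∈ Metric.ball y₀ ρ, ‖A y‖ ≤ 2 := fun y hy => by
    have h1 := hK.dist_le_mul y hy y₀ (Metric.mem_ball_self hρ)
    rw [dist_eq_norm, h0] at h1
    have h2 : (K : ℝ) * dist y y₀ ≤ 1 :=
      (mul_le_mul_of_nonneg_left (Metric.mem_ball.1 hy).le K.2).trans hKρ
    have h3 : ‖A y‖ ≤ ‖A y - ContinuousLinearMap.id ℝ E‖ + ‖ContinuousLinearMap.id ℝ E‖ := by
      simpa using norm_add_le (A y - ContinuousLinearMap.id ℝ E) (ContinuousLinearMap.id ℝ E)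
    have h4 : ‖ContinuousLinearMap.id ℝ E‖ ≤ 1 := ContinuousLinearMap.norm_id_le
    linarith
  have hPL : IsPicardLindelof (fun _ y => A y v) (tmin := -2) (tmax := 2)
      ⟨0, by norm_num⟩ y₀ (4 * ‖v‖₊) 0 (2 * ‖v‖₊) (K * ‖v‖₊) := by
    refine IsPicardLindelof.of_time_independent (fun y hy => ?_) ?_ ?_
    · refine ((A y).le_opNorm v).trans ?_
      have := hA2 y (hsub (by simpa using hy))
      push_cast
      gcongr
    · refine LipschitzOnWith.of_dist_le_mul fun y hy z hz => ?_
      rw [dist_eq_norm, ← _root_.sub_apply]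
      refine ((A y - A z).le_opNorm v).trans ?_
      have := hK.dist_le_mul y (hsub (by simpa using hy)) z (hsub (by simpa using hz))
      rw [dist_eq_norm] at this
      push_cast
      rw [mul_right_comm]
      gcongr
    · norm_num
      linarith [norm_nonneg v]
  -- The fixed point of the Picard operator is used directly, since it retains the bound on the
  -- distance from `y₀`.
  obtain ⟨α, hα⟩ := ODE.FunSpace.exists_isFixedPt_next hPL (Metric.mem_closedBall_self le_rfl)
  have hmem : ∀ t, α.compProj t ∈ Metric.closedBall y₀ (4 * ‖v‖) := fun t => by
    simpa using α.compProj_mem_closedBall hPL.mul_max_le (t := t)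
  refine ⟨α.compProj, ?_, fun t ht => ⟨?_, hmem t⟩⟩
  · have h1 := ODE.FunSpace.next_apply₀ hPL (Metric.mem_closedBall_self le_rfl) α
    rw [hα] at h1
    exact (α.compProj_val (t := ⟨0, by norm_num⟩)).trans h1
  · have h1 : HasDerivWithinAt α.compProj (A (α.compProj t) v) (Icc (-2) 2) t := by
      apply ODE.hasDerivWithinAt_picard_Icc (t₀ := 0) (by norm_num) hPL.continuousOn_uncurry
        α.continuous_compProj.continuousOn (fun _ _ => α.compProj_mem_closedBall hPL.mul_max_le)
        y₀ (Ioo_subset_Icc_self ht) |>.congr_of_mem _ (Ioo_subset_Icc_self ht)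
      intro t' ht'
      nth_rw 1 [← hα]
      rw [ODE.FunSpace.compProj_of_mem ht', ODE.FunSpace.next_apply]
    exact h1.hasDerivAt (Icc_mem_nhds ht.1 ht.2)

/-- Grönwall for `c t - d t - t • (v - w)`, whose derivative is `(A c - A d) v + (A d - A y₀) (v -
w)`. Since `K * ‖v‖ ≤ 1`, the Grönwall constant is `1`, and the factor `2` bounds `e - 1`. The
coefficient of `‖v - w‖` tends to `0` with `v` and `w`, which is strict differentiability at `0`. -/
lemma norm_sub_sub_le_of_integralCurves {A : E → E →L[ℝ] E} {y₀ : E}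
    {K : ℝ≥0} {ρ : ℝ} (hK : LipschitzOnWith K A (Metric.ball y₀ ρ)) (hρ : 0 < ρ)
    (h0 : A y₀ = ContinuousLinearMap.id ℝ E) (hKρ : K * ρ ≤ 1) {v w : E} (hv : 4 * ‖v‖ < ρ)
    (hw : 4 * ‖w‖ < ρ) {c d : ℝ → E} (hc0 : c 0 = y₀) (hd0 : d 0 = y₀)
    (hc : ∀ t ∈ Ioo (-2 : ℝ) 2,
      HasDerivAt c (A (c t) v) t ∧ c t ∈ Metric.closedBall y₀ (4 * ‖v‖))
    (hd : ∀ t ∈ Ioo (-2 : ℝ) 2,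
      HasDerivAt d (A (d t) w) t ∧ d t ∈ Metric.closedBall y₀ (4 * ‖w‖)) :
    ‖c 1 - d 1 - (v - w)‖ ≤ 2 * (K * (‖v‖ + 4 * ‖w‖) * ‖v - w‖) := by
  have hIcc : ∀ t ∈ Icc (0 : ℝ) 1, t ∈ Ioo (-2 : ℝ) 2 := fun t ht =>
    ⟨by linarith [ht.1], by linarith [ht.2]⟩
  have hderiv : ∀ t ∈ Icc (0 : ℝ) 1, HasDerivAt (fun t => c t - d t - t • (v - w))
      (A (c t) v - A (d t) w - (1 : ℝ) • (v - w)) t := fun t ht =>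
    ((hc t (hIcc t ht)).1.sub (hd t (hIcc t ht)).1).sub ((hasDerivAt_id t).smul_const (v - w))
  have hbound : ∀ t ∈ Icc (0 : ℝ) 1, ‖A (c t) v - A (d t) w - (1 : ℝ) • (v - w)‖ ≤
      1 * ‖c t - d t - t • (v - w)‖ + K * (‖v‖ + 4 * ‖w‖) * ‖v - w‖ := fun t ht => by
    have hcm := (hc t (hIcc t ht)).2
    have hdm := (hd t (hIcc t ht)).2
    have hcρ : c t ∈ Metric.ball y₀ ρ := lt_of_le_of_lt hcm hv
    have hdρ : d t ∈ Metric.ball y₀ ρ := lt_of_le_of_lt hdm hw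
    have e1 : A (c t) v - A (d t) w - (1 : ℝ) • (v - w) =
        (A (c t) - A (d t)) v + (A (d t) - A y₀) (v - w) := by
      rw [h0]
      simp only [_root_.sub_apply, map_sub, ContinuousLinearMap.id_apply, one_smul]
      abel
    have e2 : ‖A (c t) - A (d t)‖ ≤ K * (‖c t - d t - t • (v - w)‖ + ‖v - w‖) := by
      have h1 := hK.dist_le_mul _ hcρ _ hdρ
      rw [dist_eq_norm, dist_eq_norm] at h1
      refine h1.trans ?_
      gcongr
      calc ‖c t - d t‖ = ‖(c t - d t - t • (v - w)) + t • (v - w)‖ := by rw [sub_add_cancel]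
        _ ≤ ‖c t - d t - t • (v - w)‖ + ‖t • (v - w)‖ := norm_add_le _ _
        _ ≤ _ := by
          gcongr
          rw [norm_smul, Real.norm_of_nonneg ht.1]
          exact mul_le_of_le_one_left (norm_nonneg _) ht.2
    have e3 : ‖A (d t) - A y₀‖ ≤ K * (4 * ‖w‖) := by
      have h1 := hK.dist_le_mul _ hdρ _ (Metric.mem_ball_self hρ)
      rw [dist_eq_norm] at h1
      refine h1.trans ?_
      gcongr
      exact hdm
    have hKv : K * ‖v‖ ≤ 1 := by
      refine le_trans ?_ hKρ
      gcongr
      linarith [norm_nonneg v]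
    rw [e1]
    calc _ ≤ ‖A (c t) - A (d t)‖ * ‖v‖ + ‖A (d t) - A y₀‖ * ‖v - w‖ :=
          (norm_add_le _ _).trans (_root_.add_le_add (ContinuousLinearMap.le_opNorm _ _)
            (ContinuousLinearMap.le_opNorm _ _))
      _ ≤ K * (‖c t - d t - t • (v - w)‖ + ‖v - w‖) * ‖v‖ + K * (4 * ‖w‖) * ‖v - w‖ := by gcongr
      _ = (K * ‖v‖) * ‖c t - d t - t • (v - w)‖ + K * (‖v‖ + 4 * ‖w‖) * ‖v - w‖ := by ring
      _ ≤ _ := by gcongr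
  have h := norm_le_gronwallBound_of_norm_deriv_right_le (δ := 0)
    (fun t ht => (hderiv t ht).continuousAt.continuousWithinAt)
    (fun t ht => (hderiv t (Ico_subset_Icc_self ht)).hasDerivWithinAt)
    (by simp [hc0, hd0]) (fun t ht => hbound t (Ico_subset_Icc_self ht)) 1 (by norm_num)
  rw [gronwallBound_of_K_ne_0 one_ne_zero] at h
  simp only [one_smul] at h
  refine h.trans ?_
  have he : Real.exp 1 - 1 ≤ 2 := by linarith [Real.exp_one_lt_d9]
  have hn : 0 ≤ K * (‖v‖ + 4 * ‖w‖) * ‖v - w‖ := by positivity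
  norm_num
  nlinarith

/-- For the equations `c' = A c v`, `c 0 = y₀`, where `A` is Lipschitz near `y₀` and `A y₀ = 1`, the
time one map `v ↦ c 1` is defined near `0` and strictly differentiable at `0` with derivative `1`. -/
lemma exists_flow_hasStrictFDerivAt [CompleteSpace E] {A : E → E →L[ℝ] E} {y₀ : E}
    (hA : LipAt A y₀) (h0 : A y₀ = ContinuousLinearMap.id ℝ E) {U : Set E} (hU : U ∈ 𝓝 y₀) :
    ∃ η > 0, ∃ c : E → ℝ → E, (∀ v ∈ Metric.ball (0 : E) η, c v 0 = y₀ ∧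
      ∀ t ∈ Ioo (-2 : ℝ) 2, HasDerivAt (c v) (A (c v t) v) t ∧ c v t ∈ U) ∧
      HasStrictFDerivAt (fun v => c v 1) (ContinuousLinearMap.id ℝ E) 0 := by
  obtain ⟨K, s, hs, hK⟩ := hA
  obtain ⟨ρ₁, hρ₁, hball⟩ := Metric.mem_nhds_iff.1 (inter_mem hs hU)
  obtain ⟨ρ, hρ, hρle, hKρ⟩ : ∃ ρ : ℝ, 0 < ρ ∧ ρ ≤ ρ₁ ∧ K * ρ ≤ 1 := by
    refine ⟨min ρ₁ (K + 1)⁻¹, lt_min hρ₁ (by positivity), min_le_left _ _, ?_⟩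
    calc (K : ℝ) * min ρ₁ (K + 1 : ℝ)⁻¹ ≤ K * (K + 1 : ℝ)⁻¹ := by
          gcongr
          exact min_le_right _ _
      _ ≤ 1 := by
          rw [← div_eq_mul_inv, div_le_one (by positivity)]
          linarith
  have hρU : Metric.ball y₀ ρ ⊆ s ∩ U := (Metric.ball_subset_ball hρle).trans hball
  replace hK : LipschitzOnWith K A (Metric.ball y₀ ρ) := hK.mono fun y hy => (hρU hy).1
  have hex := fun (v : E) (hv : 4 * ‖v‖ < ρ) =>
    exists_integralCurve_of_lipschitzOnWith hK hρ h0 hKρ hv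
  choose! c hc0 hc using hex
  have hη : ∀ v ∈ Metric.ball (0 : E) (ρ / 4), 4 * ‖v‖ < ρ := fun v hv => by
    rw [mem_ball_zero_iff] at hv
    linarith
  refine ⟨ρ / 4, by positivity, c, fun v hv => ⟨hc0 v (hη v hv), fun t ht =>
    ⟨(hc v (hη v hv) t ht).1, (hρU (lt_of_le_of_lt (hc v (hη v hv) t ht).2 (hη v hv))).2⟩⟩, ?_⟩
  refine .of_isLittleO (Asymptotics.isLittleO_iff.2 fun ε hε => ?_)
  -- With `‖v‖` and `‖w‖` below this bound, `2 * K * (‖v‖ + 4 * ‖w‖) ≤ ε`; the `+ 1` covers `K = 0`.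
  have hδ : 0 < min (ρ / 4) (ε / (10 * (K + 1))) := lt_min (by positivity) (by positivity)
  filter_upwards [prod_mem_nhds (Metric.ball_mem_nhds (0 : E) hδ)
    (Metric.ball_mem_nhds (0 : E) hδ)] with p hp
  obtain ⟨v, w⟩ := p
  obtain ⟨hv, hw⟩ := hp
  rw [mem_ball_zero_iff] at hv hw
  have hv4 := hη v (mem_ball_zero_iff.2 (hv.trans_le (min_le_left _ _)))
  have hw4 := hη w (mem_ball_zero_iff.2 (hw.trans_le (min_le_left _ _)))
  refine (norm_sub_sub_le_of_integralCurves hK hρ h0 hKρ hv4 hw4 (hc0 v hv4) (hc0 w hw4)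
    (hc v hv4) (hc w hw4)).trans ?_
  have hv' := (hv.trans_le (min_le_right _ _)).le
  have hw' := (hw.trans_le (min_le_right _ _)).le
  simp only at hv' hw' ⊢
  rw [← mul_assoc]
  gcongr
  have h5 : ‖v‖ + 4 * ‖w‖ ≤ 5 * (ε / (10 * (K + 1))) := by linarith
  calc 2 * (K * (‖v‖ + 4 * ‖w‖)) ≤ 2 * ((K + 1) * (5 * (ε / (10 * (K + 1))))) := by
        gcongr
        linarith
    _ = ε := by
        field_simp
        norm_num

end ParametrizedFlow

/-! ### The exponential map of a Lie group -/

section LieGroupExp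

variable {E : Type*} [NormedAddCommGroup E] [NormedSpace ℝ E]
  {G : Type*} [TopologicalSpace G] [ChartedSpace E G] [Group G]

variable (E G) in
lemma LieGroup.t2Space [LieGroup 𝓘(ℝ, E) 3 G] : T2Space G := by
  have : IsTopologicalGroup G := topologicalGroup_of_lieGroup 𝓘(ℝ, E) 3
  have : T1Space G := ChartedSpace.t1Space E G
  infer_instance

variable [LieGroup 𝓘(ℝ, E) 3 G]

lemma contMDiff_one_mulInvariantVectorField (v : GroupLieAlgebra 𝓘(ℝ, E) G) :
    ContMDiff 𝓘(ℝ, E) 𝓘(ℝ, E).tangent 1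
      (fun g : G => (mulInvariantVectorField v g : TangentBundle 𝓘(ℝ, E) G)) := by
  have : LieGroup 𝓘(ℝ, E) (minSmoothness ℝ 3) G := by
    rw [minSmoothness_of_isRCLikeNormedField]
    infer_instance
  have h := contMDiff_mulInvariantVectorField (I := 𝓘(ℝ, E)) v
  exact h.of_le (by rw [minSmoothness_of_isRCLikeNormedField]; norm_num)

lemma mdifferentiable_const_mul (a : G) :
    MDifferentiable 𝓘(ℝ, E) 𝓘(ℝ, E) (fun b : G => a * b) :=
  (contMDiff_mul_left (I := 𝓘(ℝ, E)) (n := 3) (a := a)).mdifferentiable (by norm_num)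

/-- A map `F` with `F (a * b) = F a * φ b` sends integral curves of left invariant vector fields to
integral curves of left invariant vector fields. -/
lemma IsMIntegralCurveOn.map_mulInvariantVectorField {F φ : G → G}
    (hF : MDifferentiable 𝓘(ℝ, E) 𝓘(ℝ, E) F) (hφ : MDifferentiableAt 𝓘(ℝ, E) 𝓘(ℝ, E) φ 1)
    (hφ1 : φ 1 = 1) (hFφ : ∀ a b, F (a * b) = F a * φ b)
    {v w : GroupLieAlgebra 𝓘(ℝ, E) G} (hvw : (mfderiv 𝓘(ℝ, E) 𝓘(ℝ, E) φ 1 : E →L[ℝ] E) v = w)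
    {γ : ℝ → G} {s : Set ℝ} (hγ : IsMIntegralCurveOn γ (mulInvariantVectorField v) s) :
    IsMIntegralCurveOn (F ∘ γ) (mulInvariantVectorField w) s := by
  intro t ht
  have h := ((hF (γ t)).hasMFDerivAt).comp_hasMFDerivWithinAt t (hγ t ht)
  -- Differentiate `F ∘ (a * ·) = (F a * ·) ∘ φ` at `1`.
  have key : ∀ a : G, (mfderiv 𝓘(ℝ, E) 𝓘(ℝ, E) F a : E →L[ℝ] E)
      (mfderiv 𝓘(ℝ, E) 𝓘(ℝ, E) (fun b : G => a * b) 1 v) =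
      (mfderiv 𝓘(ℝ, E) 𝓘(ℝ, E) (fun b : G => F a * b) 1 : E →L[ℝ] E) w := fun a => by
    have h1 := (hF (a * 1)).hasMFDerivAt.comp (1 : G)
      ((mdifferentiable_const_mul (E := E) a) 1).hasMFDerivAt
    have h2 := ((mdifferentiable_const_mul (E := E) (F a)) (φ 1)).hasMFDerivAt.comp (1 : G)
      hφ.hasMFDerivAt
    have h3 : (F ∘ fun b => a * b) = (fun b => F a * b) ∘ φ := funext fun b => hFφ a b
    rw [h3] at h1
    have h4 := congrArg (fun L : E →L[ℝ] E => L v) (hasMFDerivAt_unique h1 h2)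
    let D : (G → G) → G → E →L[ℝ] E := fun f b => mfderiv 𝓘(ℝ, E) 𝓘(ℝ, E) f b
    have e1 : D F (a * 1) = D F a := congrArg (D F) (mul_one a)
    have e2 : D (fun b => F a * b) (φ 1) = D (fun b => F a * b) 1 := congrArg (D _) hφ1
    change D F a _ = D (fun b => F a * b) 1 w
    rw [← e1, ← e2, ← hvw]
    exact h4
  refine Eq.mp (congrArg (HasMFDerivWithinAt 𝓘(ℝ, ℝ) 𝓘(ℝ, E) (F ∘ γ) s t)
    (ContinuousLinearMap.ext fun (r : ℝ) => ?_)) h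
  have h5 := congrArg (fun x : E => r • x) (key (γ t))
  refine Eq.trans ?_ h5
  exact ((mfderiv 𝓘(ℝ, E) 𝓘(ℝ, E) F (γ t) : E →L[ℝ] E).map_smul r _)

/-- Integral curves of `C^1` fields on a Hausdorff manifold are unique, so the choice made in
`lieExp` is irrelevant. -/
lemma IsMIntegralCurve.lieExp_eq {v : GroupLieAlgebra 𝓘(ℝ, E) G} {γ : ℝ → G} (h0 : γ 0 = 1)
    (hγ : IsMIntegralCurve γ (mulInvariantVectorField v)) : lieExp v = γ 1 := by
  have := LieGroup.t2Space E G
  have : IsManifold 𝓘(ℝ, E) 1 G := IsManifold.of_le (n := 3) (by norm_num)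
  obtain ⟨δ, hδ0, hδ, hδ1⟩ := Classical.epsilon_spec
    (⟨γ 1, γ, h0, hγ, rfl⟩ : ∃ a : G, ∃ γ : ℝ → G, γ 0 = 1 ∧
      IsMIntegralCurve γ (mulInvariantVectorField v) ∧ γ 1 = a)
  have := isMIntegralCurve_Ioo_eq_of_contMDiff_boundaryless (t₀ := 0)
    (contMDiff_one_mulInvariantVectorField v) hδ hγ (hδ0.trans h0.symm)
  rw [← this]
  exact hδ1.symm

/-- An integral curve through `1` of a left invariant vector field extends to all times. -/
lemma IsMIntegralCurveOn.exists_global {v : GroupLieAlgebra 𝓘(ℝ, E) G} {γ : ℝ → G} (h0 : γ 0 = 1)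
    {ε : ℝ} (hε : 0 < ε)
    (hγ : IsMIntegralCurveOn γ (mulInvariantVectorField v) (Ioo (-ε) ε)) :
    ∃ δ : ℝ → G, δ 0 = 1 ∧ IsMIntegralCurve δ (mulInvariantVectorField v) ∧
      EqOn δ γ (Ioo (-ε) ε) := by
  have := LieGroup.t2Space E G
  have : IsManifold 𝓘(ℝ, E) 1 G := IsManifold.of_le (n := 3) (by norm_num)
  -- Left translates of `γ` are integral curves through every point with the same existence time
  -- `ε`, hence curves extend forever.
  obtain ⟨δ, hδ0, hδ⟩ := exists_isMIntegralCurve_of_isMIntegralCurveOn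
    (contMDiff_one_mulInvariantVectorField v) hε (fun a => ⟨(fun b => a * b) ∘ γ, by simp [h0],
      hγ.map_mulInvariantVectorField (φ := id) (mdifferentiable_const_mul a) mdifferentiableAt_id
        rfl (fun b c => (mul_assoc a b c).symm) (by rw [mfderiv_id]; rfl)⟩) 1
  exact ⟨δ, hδ0, hδ, isMIntegralCurveOn_Ioo_eqOn_of_contMDiff_boundaryless (t₀ := 0)
    ⟨by linarith, hε⟩ (contMDiff_one_mulInvariantVectorField v) (hδ.isMIntegralCurveOn _) hγ
    (hδ0.trans h0.symm)⟩

/-- The exponential map is natural with respect to smooth homomorphisms. -/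
lemma lieExp_map {φ : G → G} (hφ : MDifferentiable 𝓘(ℝ, E) 𝓘(ℝ, E) φ)
    (hmul : ∀ a b, φ (a * b) = φ a * φ b) {v w : GroupLieAlgebra 𝓘(ℝ, E) G}
    (hvw : (mfderiv 𝓘(ℝ, E) 𝓘(ℝ, E) φ 1 : E →L[ℝ] E) v = w)
    (hv : ∃ γ : ℝ → G, γ 0 = 1 ∧ IsMIntegralCurve γ (mulInvariantVectorField v)) :
    lieExp w = φ (lieExp v) := by
  obtain ⟨γ, h0, hγ⟩ := hv
  have h1 : φ 1 = 1 := by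
    have h := hmul 1 1
    rw [mul_one] at h
    exact left_eq_mul.1 h
  have hφγ : IsMIntegralCurve (φ ∘ γ) (mulInvariantVectorField w) := by
    rw [isMIntegralCurve_iff_isMIntegralCurveOn] at hγ ⊢
    exact hγ.map_mulInvariantVectorField hφ (hφ 1) h1 hmul hvw
  rw [hγ.lieExp_eq h0, hφγ.lieExp_eq (by simp [h0, h1])]
  rfl

lemma lieExp_zero : lieExp (0 : GroupLieAlgebra 𝓘(ℝ, E) G) = (1 : G) :=
  IsMIntegralCurve.lieExp_eq (γ := fun _ => 1) rfl
    (isMIntegralCurve_const (by simp [mulInvariantVectorField]; rfl))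

end LieGroupExp

/-! ### The exponential map near zero, in the chart at the identity -/

section LieGroupExpChart

variable {E : Type*} [NormedAddCommGroup E] [NormedSpace ℝ E]
  {G : Type*} [TopologicalSpace G] [ChartedSpace E G] [Group G]

variable (E G) in
/-- The multiplication of `G`, read in the chart at `1`. -/
def chartMul (y b : E) : E :=
  chartAt E (1 : G) ((chartAt E (1 : G)).symm y * (chartAt E (1 : G)).symm b)

variable (E G) in
/-- The left invariant vector fields, read in the chart at `1`. -/
noncomputable def chartLeftInvariant (y : E) : E →L[ℝ] E :=
  fderiv ℝ (chartMul E G y) (chartAt E (1 : G) 1)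

variable (E G) in
lemma chartLeftInvariant_base :
    chartLeftInvariant E G (chartAt E (1 : G) 1) = ContinuousLinearMap.id ℝ E := by
  have h : chartMul E G (chartAt E (1 : G) 1) =ᶠ[𝓝 (chartAt E (1 : G) 1)] id := by
    filter_upwards [(chartAt E (1 : G)).open_target.mem_nhds (mem_chart_target E (1 : G))]
      with b hb
    simp [chartMul, hb]
  rw [chartLeftInvariant, h.fderiv_eq, fderiv_id]

variable [LieGroup 𝓘(ℝ, E) 3 G]

lemma contMDiffAt_mul_chart_symm {y b : E} (hy : y ∈ (chartAt E (1 : G)).target)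
    (hb : b ∈ (chartAt E (1 : G)).target) :
    ContMDiffAt 𝓘(ℝ, E × E) 𝓘(ℝ, E) 3
      (fun p : E × E => (chartAt E (1 : G)).symm p.1 * (chartAt E (1 : G)).symm p.2) (y, b) := by
  have hs : ∀ z ∈ (chartAt E (1 : G)).target,
      ContMDiffAt 𝓘(ℝ, E) 𝓘(ℝ, E) 3 (chartAt E (1 : G)).symm z := fun z hz =>
    (contMDiffOn_chart_symm (I := 𝓘(ℝ, E)) (n := 3)).contMDiffAt
      ((chartAt E (1 : G)).open_target.mem_nhds hz)
  have h1 : ContMDiffAt 𝓘(ℝ, E × E) 𝓘(ℝ, E) 3 (Prod.fst : E × E → E) (y, b) :=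
    contDiff_fst.contMDiff.contMDiffAt
  have h2 : ContMDiffAt 𝓘(ℝ, E × E) 𝓘(ℝ, E) 3 (Prod.snd : E × E → E) (y, b) :=
    contDiff_snd.contMDiff.contMDiffAt
  exact ((hs y hy).comp (y, b) h1).mul ((hs b hb).comp (y, b) h2)

lemma contDiffAt_chartMul {y b : E} (hy : y ∈ (chartAt E (1 : G)).target)
    (hb : b ∈ (chartAt E (1 : G)).target)
    (hyb : (chartAt E (1 : G)).symm y * (chartAt E (1 : G)).symm b ∈ (chartAt E (1 : G)).source) :
    ContDiffAt ℝ 3 (Function.uncurry (chartMul E G)) (y, b) := by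
  rw [← contMDiffAt_iff_contDiffAt]
  have h := (contMDiffOn_chart (I := 𝓘(ℝ, E)) (n := 3) (x := (1 : G))).contMDiffAt
    ((chartAt E (1 : G)).open_source.mem_nhds hyb)
  exact ContMDiffAt.comp (y, b) h (contMDiffAt_mul_chart_symm hy hb)

variable (E G) in
-- The multiplication is `C^3`, so its partial derivative is still `C^1`, hence Lipschitz near the
-- base point.
lemma lipAt_chartLeftInvariant : LipAt (chartLeftInvariant E G) (chartAt E (1 : G) 1) := by
  have h := contDiffAt_chartMul (mem_chart_target E (1 : G)) (mem_chart_target E (1 : G)) (by simp)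
  exact (h.fderiv (g := fun _ => chartAt E (1 : G) 1) (m := 1) contDiffAt_const
    (by norm_num)).lipAt

lemma hasMFDerivAt_chart_symm_one :
    HasMFDerivAt 𝓘(ℝ, E) 𝓘(ℝ, E) (chartAt E (1 : G)).symm (chartAt E (1 : G) 1)
      (ContinuousLinearMap.id ℝ E) := by
  have : IsManifold 𝓘(ℝ, E) 1 G := IsManifold.of_le (n := 3) (by norm_num)
  have h1 := mfderivWithin_range_extChartAt_symm (I := 𝓘(ℝ, E)) (x := (1 : G))
  have h2 : MDifferentiableAt 𝓘(ℝ, E) 𝓘(ℝ, E) (chartAt E (1 : G)).symm (chartAt E (1 : G) 1) :=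
    mdifferentiableAt_atlas_symm (chart_mem_atlas E (1 : G)) (mem_chart_target E (1 : G))
  have h3 := h2.hasMFDerivAt
  simp only [mfld_simps, mfderivWithin_univ] at h1
  rw [h1] at h3
  exact h3

/-- Differentiate `φ.symm ∘ chartMul E G y = (φ.symm y * ·) ∘ φ.symm`, valid near `φ 1`. There
`φ.symm` has derivative the identity, because `T₁ G` is identified with `E` by this very chart. -/
lemma mfderiv_chart_symm_chartLeftInvariant {y : E} (hy : y ∈ (chartAt E (1 : G)).target) (v : E) :
    (mfderiv 𝓘(ℝ, E) 𝓘(ℝ, E) (chartAt E (1 : G)).symm y : E →L[ℝ] E)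
      (chartLeftInvariant E G y v) =
    mulInvariantVectorField (I := 𝓘(ℝ, E)) (G := G) v ((chartAt E (1 : G)).symm y) := by
  have : IsManifold 𝓘(ℝ, E) 1 G := IsManifold.of_le (n := 3) (by norm_num)
  set φ := chartAt E (1 : G) with hφ
  have h1s : φ.symm (φ 1) = 1 := φ.left_inv (mem_chart_source E (1 : G))
  have hμy : chartMul E G y (φ 1) = y := by
    simp only [chartMul, ← hφ, h1s, mul_one]
    exact φ.right_inv hy
  have hd : DifferentiableAt ℝ (chartMul E G y) (φ 1) := by
    have h := contDiffAt_chartMul hy (mem_chart_target E (1 : G))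
      (by simpa [← hφ, h1s] using φ.map_target hy)
    exact (h.comp (φ 1) (contDiffAt_const.prodMk contDiffAt_id :
      ContDiffAt ℝ 3 (fun b : E => (y, b)) (φ 1))).differentiableAt (by norm_num)
  have hs : MDifferentiableAt 𝓘(ℝ, E) 𝓘(ℝ, E) φ.symm (chartMul E G y (φ 1)) := by
    rw [hμy]
    exact mdifferentiableAt_atlas_symm (chart_mem_atlas E (1 : G)) hy
  have hL := hs.hasMFDerivAt.comp (φ 1) hd.hasFDerivAt.hasMFDerivAt
  have hM : MDifferentiableAt 𝓘(ℝ, E) 𝓘(ℝ, E) (fun b : G => φ.symm y * b) (φ.symm (φ 1)) :=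
    mdifferentiable_const_mul _ _
  have hR := hM.hasMFDerivAt.comp (φ 1) hasMFDerivAt_chart_symm_one
  have hev : (φ.symm ∘ chartMul E G y) =ᶠ[𝓝 (φ 1)] (fun b : G => φ.symm y * b) ∘ φ.symm := by
    have hc : ContinuousAt (fun b => φ.symm y * φ.symm b) (φ 1) := by
      have : IsTopologicalGroup G := topologicalGroup_of_lieGroup 𝓘(ℝ, E) 3
      exact continuousAt_const.mul (φ.continuousAt_symm (mem_chart_target E (1 : G)))
    have hmem : φ.symm y * φ.symm (φ 1) ∈ φ.source := by
      simpa [h1s] using φ.map_target hy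
    filter_upwards [hc (φ.open_source.mem_nhds hmem)] with b hb
    exact φ.left_inv hb
  have huniq := congrArg (fun L : E →L[ℝ] E => L v)
    (hasMFDerivAt_unique (hL.congr_of_eventuallyEq hev.symm) hR)
  let D : E → E →L[ℝ] E := fun b => mfderiv 𝓘(ℝ, E) 𝓘(ℝ, E) φ.symm b
  let D' : G → E →L[ℝ] E := fun b => mfderiv 𝓘(ℝ, E) 𝓘(ℝ, E) (fun b : G => φ.symm y * b) b
  have e1 : D (chartMul E G y (φ 1)) = D y := congrArg D hμy
  have e2 : D' (φ.symm (φ 1)) = D' 1 := congrArg D' h1s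
  change D y (chartLeftInvariant E G y v) = D' 1 v
  rw [← e1, ← e2]
  exact huniq

/-- Near `0`, the exponential map is a homeomorphism onto an open subset of `G`. -/
lemma exists_openPartialHomeomorph_lieExp [CompleteSpace E] :
    ∃ r > 0, ∃ Θ : OpenPartialHomeomorph E G, Θ.source = Metric.ball 0 r ∧
      ∀ v ∈ Metric.ball (0 : E) r, lieExp (E := E) (G := G) v = Θ v ∧
        ∃ γ : ℝ → G, γ 0 = 1 ∧
          IsMIntegralCurve γ (mulInvariantVectorField (I := 𝓘(ℝ, E)) (G := G) v) := by
  set φ := chartAt E (1 : G) with hφ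
  obtain ⟨η, hη, c, hc, hstrict⟩ := exists_flow_hasStrictFDerivAt (lipAt_chartLeftInvariant E G)
    (chartLeftInvariant_base E G) (φ.open_target.mem_nhds (mem_chart_target E (1 : G)))
  have hint : ∀ v ∈ Metric.ball (0 : E) η, IsMIntegralCurveOn (fun t => φ.symm (c v t))
      (mulInvariantVectorField (I := 𝓘(ℝ, E)) (G := G) v) (Ioo (-2) 2) := fun v hv t ht => by
    obtain ⟨-, hcv⟩ := hc v hv
    obtain ⟨hd, hmem⟩ := hcv t ht
    have : IsManifold 𝓘(ℝ, E) 1 G := IsManifold.of_le (n := 3) (by norm_num)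
    have h1 : MDifferentiableAt 𝓘(ℝ, E) 𝓘(ℝ, E) φ.symm (c v t) :=
      mdifferentiableAt_atlas_symm (chart_mem_atlas E (1 : G)) hmem
    have h2 := h1.hasMFDerivAt.comp t hd.hasFDerivAt.hasMFDerivAt
    refine HasMFDerivAt.hasMFDerivWithinAt ?_
    refine Eq.mp (congrArg (HasMFDerivAt 𝓘(ℝ, ℝ) 𝓘(ℝ, E) (fun t => φ.symm (c v t)) t)
      (ContinuousLinearMap.ext fun (r : ℝ) => ?_)) h2
    have h3 := congrArg (fun x : E => r • x) (mfderiv_chart_symm_chartLeftInvariant hmem v)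
    refine Eq.trans ?_ h3
    exact (mfderiv 𝓘(ℝ, E) 𝓘(ℝ, E) φ.symm (c v t) : E →L[ℝ] E).map_smul r _
  have h01 : ∀ v ∈ Metric.ball (0 : E) η, φ.symm (c v 0) = 1 := fun v hv => by
    rw [(hc v hv).1]
    exact φ.left_inv (mem_chart_source E (1 : G))
  have hf : HasStrictFDerivAt (fun v => c v 1)
      ((ContinuousLinearEquiv.refl ℝ E : E ≃L[ℝ] E) : E →L[ℝ] E) 0 := hstrict
  -- Inverse function theorem for the time one map, followed by the inverse chart.
  let Ψ := (hf.toOpenPartialHomeomorph (fun v => c v 1)).trans φ.symm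
  have h0Ψ : (0 : E) ∈ Ψ.source := by
    rw [OpenPartialHomeomorph.trans_source]
    exact ⟨hf.mem_toOpenPartialHomeomorph_source,
      ((hc 0 (Metric.mem_ball_self hη)).2 1 (by norm_num)).2⟩
  obtain ⟨r, hr, hball⟩ := Metric.mem_nhds_iff.1
    (inter_mem (Ψ.open_source.mem_nhds h0Ψ) (Metric.ball_mem_nhds (0 : E) hη))
  refine ⟨r, hr, Ψ.restrOpen (Metric.ball 0 r) Metric.isOpen_ball, ?_, fun v hv => ?_⟩
  · rw [OpenPartialHomeomorph.restrOpen_source]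
    exact inter_eq_right.2 fun v hv => (hball hv).1
  · have hvη := (hball hv).2
    obtain ⟨δ, hδ0, hδ, hδe⟩ := (hint v hvη).exists_global (h01 v hvη) (by norm_num)
    refine ⟨?_, δ, hδ0, hδ⟩
    rw [hδ.lieExp_eq hδ0, hδe (by norm_num)]
    rfl

end LieGroupExpChart

/-! ### Trivializations as bijections on fibres -/

section TrivializationFibers

variable {B G : Type*} [TopologicalSpace B] [TopologicalSpace G] {F : B → Type*}
  [TopologicalSpace (TotalSpace G F)] (e : Trivialization G (π G F)) {x : B}

lemma Trivialization.mk_snd_apply (hx : x ∈ e.baseSet) (b : F x) :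
    e ⟨x, b⟩ = (x, (e ⟨x, b⟩).2) :=
  Prod.ext (e.coe_fst' hx) rfl

lemma Trivialization.symm_mk_snd (hx : x ∈ e.baseSet) (b : F x) :
    e.toOpenPartialHomeomorph.symm (x, (e ⟨x, b⟩).2) = ⟨x, b⟩ := by
  rw [← Trivialization.mk_snd_apply e hx]
  exact e.toOpenPartialHomeomorph.left_inv (e.mem_source.2 hx)

lemma Trivialization.snd_injective (hx : x ∈ e.baseSet) :
    Function.Injective fun b : F x => (e ⟨x, b⟩).2 := fun b c h => by
  have h1 := Trivialization.symm_mk_snd e hx b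
  rw [show (e ⟨x, b⟩).2 = (e ⟨x, c⟩).2 from h, Trivialization.symm_mk_snd e hx c] at h1
  exact TotalSpace.mk_injective x h1.symm

lemma Trivialization.snd_surjective (hx : x ∈ e.baseSet) :
    Function.Surjective fun b : F x => (e ⟨x, b⟩).2 := fun a => by
  have h1 : (e.toOpenPartialHomeomorph.symm (x, a)).1 = x := e.proj_symm_apply' hx
  have h2 : e (e.toOpenPartialHomeomorph.symm (x, a)) = (x, a) := e.apply_symm_apply' hx
  generalize e.toOpenPartialHomeomorph.symm (x, a) = z at h1 h2
  obtain ⟨y, b⟩ := z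
  obtain rfl : y = x := h1
  exact ⟨b, congrArg Prod.snd h2⟩

end TrivializationFibers

/-! ### Existence of normal neighbourhoods -/

section NormalNeighborhoods

variable {X : Type*} [NormedAddCommGroup X] [NormedSpace ℝ X] {Ω : Opens X}
  {E : Type*} [NormedAddCommGroup E] [NormedSpace ℝ E]
  {G : Type*} [TopologicalSpace G] [ChartedSpace E G] [Group G]
  {Γ : Ω → Type*} [TopologicalSpace (TotalSpace G Γ)] [∀ x, TopologicalSpace (Γ x)]
  [∀ x, Group (Γ x)] [FiberBundle G Γ]

variable (E) in
lemma fiberCoordChange_mul [IsLieGroupBundle Ω E G 3 Γ] {e e' : Trivialization G (π G Γ)}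
    (he : e ∈ FiberBundle.trivializationAtlas G Γ) (he' : e' ∈ FiberBundle.trivializationAtlas G Γ)
    {x : Ω} (hx : x ∈ e.baseSet) (hx' : x ∈ e'.baseSet) (a b : G) :
    fiberCoordChange e e' x (a * b) = fiberCoordChange e e' x a * fiberCoordChange e e' x b := by
  obtain ⟨a, rfl⟩ := Trivialization.snd_surjective e hx a
  obtain ⟨b, rfl⟩ := Trivialization.snd_surjective e hx b
  simp only
  rw [← IsLieGroupBundle.map_mul (Ω := Ω) (E := E) (n := 3) e he x hx a b]
  simp only [fiberCoordChange, Trivialization.symm_mk_snd e hx]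
  exact IsLieGroupBundle.map_mul (Ω := Ω) (E := E) (n := 3) e' he' x hx' a b

variable (E) in
lemma trivialization_one [IsLieGroupBundle Ω E G 3 Γ] {e : Trivialization G (π G Γ)}
    (he : e ∈ FiberBundle.trivializationAtlas G Γ) {x : Ω} (hx : x ∈ e.baseSet) :
    (e (⟨x, 1⟩ : TotalSpace G Γ)).2 = 1 := by
  have h := IsLieGroupBundle.map_mul (Ω := Ω) (E := E) (n := 3) e he x hx 1 1
  rw [mul_one] at h
  exact left_eq_mul.1 h

variable [IsLieGroupBundle Ω E G 3 Γ] [LieGroup 𝓘(ℝ, E) 3 G]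

/-- In any trivialization of `Γ`, the fibrewise exponential map is that of `G`. -/
lemma trivialization_bundleExp {e : Trivialization G (π G Γ)}
    (he : e ∈ FiberBundle.trivializationAtlas G Γ) (p : TotalSpace E (LieFiber E G Γ))
    (hp : p.1 ∈ e.baseSet)
    (hγ : ∃ γ : ℝ → G, γ 0 = 1 ∧ IsMIntegralCurve γ (mulInvariantVectorField (I := 𝓘(ℝ, E)) (G := G)
      ((lieAlgebraBundle E G Γ).localTriv ⟨e, he⟩ p).2)) :
    e (bundleExp E G Γ p) =
      (p.1, lieExp (E := E) (G := G) ((lieAlgebraBundle E G Γ).localTriv ⟨e, he⟩ p).2) := by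
  obtain ⟨x, v⟩ := p
  set w : E := ((lieAlgebraBundle E G Γ).localTriv ⟨e, he⟩ ⟨x, v⟩).2 with hw
  let τ := FiberBundle.trivializationAt G Γ x
  have hτ : τ ∈ FiberBundle.trivializationAtlas G Γ := FiberBundle.trivialization_mem_atlas G Γ x
  have hxτ : x ∈ τ.baseSet := FiberBundle.mem_baseSet_trivializationAt G Γ x
  have hxe : x ∈ e.baseSet := hp
  -- `fiberExp` is defined through the preferred trivialization `τ`. The change from `e` to `τ` is a
  -- smooth automorphism of `G` whose derivative at `1` takes `w` back to `v`, so naturality of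
  -- `exp` applies.
  have hwv : lieCoordChange E e τ x w = v := by
    have h1 := (lieAlgebraBundle E G Γ).coordChange_comp ⟨τ, hτ⟩ ⟨e, he⟩ ⟨τ, hτ⟩ x
      ⟨⟨hxτ, hxe⟩, hxτ⟩ v
    rw [(lieAlgebraBundle E G Γ).coordChange_self ⟨τ, hτ⟩ x hxτ v] at h1
    exact h1
  have hexp : lieExp (E := E) (G := G) v =
      fiberCoordChange e τ x (lieExp (E := E) (G := G) w) :=
    lieExp_map (E := E) (G := G)
      (fun a => mdifferentiableAt_fiberCoordChange he hτ ⟨hxe, hxτ⟩ a)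
      (fiberCoordChange_mul E he hτ hxe hxτ) hwv hγ
  obtain ⟨b, hb⟩ := Trivialization.snd_surjective e hxe (lieExp (E := E) (G := G) w)
  have hfib : fiberExp E G Γ x v = b := by
    have h1 : lieExp (E := E) (G := G) v = (τ ⟨x, b⟩).2 := by
      rw [hexp, ← hb, fiberCoordChange, Trivialization.symm_mk_snd e hxe]
    rw [fiberExp, h1]
    exact Function.leftInverse_invFun (Trivialization.snd_injective τ hxτ) b
  simp only [bundleExp, hfib]
  rw [Trivialization.mk_snd_apply e hxe]
  exact congrArg (Prod.mk x) hb

variable (E G Γ) in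
lemma fiberExp_zero (x : Ω) : fiberExp E G Γ x 0 = 1 := by
  have hx := FiberBundle.mem_baseSet_trivializationAt G Γ x
  have h0 : lieExp (E := E) (G := G) (0 : E) = (FiberBundle.trivializationAt G Γ x ⟨x, 1⟩).2 :=
    (lieExp_zero (E := E) (G := G)).trans
      (trivialization_one E (FiberBundle.trivialization_mem_atlas G Γ x) hx).symm
  have h1 : fiberExp E G Γ x 0 = Function.invFun
      (fun a : Γ x => (FiberBundle.trivializationAt G Γ x ⟨x, a⟩).2)
      (lieExp (E := E) (G := G) (0 : E)) := rfl
  rw [h1, h0]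
  exact Function.leftInverse_invFun (Trivialization.snd_injective _ hx) 1

variable (E G Γ) in
/-- Normal neighbourhoods exist, and can be chosen to be fibrewise star-shaped. -/
theorem exists_isNormalNeighborhood [CompleteSpace E] :
    ∃ N, IsNormalNeighborhood E G Γ N ∧ ∀ x (v : LieFiber E G Γ x),
      (⟨x, v⟩ : TotalSpace E (LieFiber E G Γ)) ∈ N → ∀ t ∈ Icc (0 : ℝ) 1,
        (⟨x, t • v⟩ : TotalSpace E (LieFiber E G Γ)) ∈ N := by
  obtain ⟨r, hr, Θ, hΘ, hexp⟩ := exists_openPartialHomeomorph_lieExp (E := E) (G := G)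
  let e : Ω → Trivialization G (π G Γ) := fun x => FiberBundle.trivializationAt G Γ x
  have he : ∀ x, e x ∈ FiberBundle.trivializationAtlas G Γ :=
    fun x => FiberBundle.trivialization_mem_atlas G Γ x
  let L : Ω → Trivialization E (π E (LieFiber E G Γ)) :=
    fun x => (lieAlgebraBundle E G Γ).localTriv ⟨e x, he x⟩
  have hLlin : ∀ i x (v : LieFiber E G Γ x) (t : ℝ),
      (L i ⟨x, t • v⟩).2 = t • (L i ⟨x, v⟩).2 := fun i x v t => by
    simp only [L, VectorBundleCore.localTriv_apply]
    exact ContinuousLinearMap.map_smul _ t v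
  obtain ⟨U, hUo, hUc, hUf, hU⟩ := precise_refinement (fun x => (e x).baseSet)
    (fun x => (e x).open_baseSet)
    (iUnion_eq_univ_iff.2 fun x => ⟨x, FiberBundle.mem_baseSet_trivializationAt G Γ x⟩)
  obtain ⟨T, hTc, hTo, hTU⟩ := exists_iUnion_eq_closure_subset hUo hUf.point_finite hUc
  have hTf : LocallyFinite fun i => closure (T i) := hUf.subset hTU
  have hTe : ∀ i, closure (T i) ⊆ (e i).baseSet := fun i => (hTU i).trans (hU i)
  have hproj : Continuous (fun p : TotalSpace E (LieFiber E G Γ) => p.1) :=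
    FiberBundle.continuous_proj E (LieFiber E G Γ)
  -- All trivializations relevant at a point must see a vector of norm less than `r`. Using closures
  -- makes the complement a locally finite union of closed sets, and norm bounds are star-shaped.
  let N : Set (TotalSpace E (LieFiber E G Γ)) := {p | ∀ i, p.1 ∈ closure (T i) → ‖(L i p).2‖ < r}
  have hNo : IsOpen N := by
    have hcl : IsClosed (⋃ i, {p : TotalSpace E (LieFiber E G Γ) | p.1 ∈ closure (T i)} ∩
        (fun p => ‖(L i p).2‖) ⁻¹' Ici r) := by
      refine LocallyFinite.isClosed_iUnion ((hTf.preimage_continuous hproj).subset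
        fun n => inter_subset_left) fun i => ?_
      refine ContinuousOn.preimage_isClosed_of_isClosed ?_
        (isClosed_closure.preimage hproj) isClosed_Ici
      refine (continuous_norm.comp continuous_snd).comp_continuousOn
        ((L i).continuousOn.mono fun p hp => ?_)
      exact (L i).mem_source.2 (hTe i hp)
    convert! hcl.isOpen_compl using 1
    ext p
    simp [N]
  -- The exponential map in the `i`-th trivialization; on the part of `N` over `T i` it coincides
  -- with `bundleExp`.
  let Bi : Ω → OpenPartialHomeomorph (TotalSpace E (LieFiber E G Γ)) (TotalSpace G Γ) := fun i =>
    ((L i).toOpenPartialHomeomorph.trans ((OpenPartialHomeomorph.refl Ω).prod Θ)).trans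
      (e i).toOpenPartialHomeomorph.symm
  have hBsrc : ∀ i, ∀ p ∈ N, p.1 ∈ T i → p ∈ (Bi i).source := fun i p hp hpi => by
    have hpb : p.1 ∈ (e i).baseSet := hTe i (subset_closure hpi)
    have h1 : (L i p).2 ∈ Θ.source := by
      rw [hΘ, mem_ball_zero_iff]
      exact hp i (subset_closure hpi)
    simp only [Bi, OpenPartialHomeomorph.trans_source, OpenPartialHomeomorph.symm_source,
      mem_inter_iff, mem_preimage]
    refine ⟨⟨(L i).mem_source.2 hpb, mem_prod.2 ⟨mem_univ _, h1⟩⟩, (e i).mem_target.2 ?_⟩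
    have : (L i p).1 = p.1 := (L i).coe_fst' (x := p) hpb
    simpa [this] using! hpb
  have hBeq : ∀ i, ∀ p ∈ N, p.1 ∈ T i → bundleExp E G Γ p = Bi i p := fun i p hp hpi => by
    have hpb : p.1 ∈ (e i).baseSet := hTe i (subset_closure hpi)
    have h1 : (L i p).2 ∈ Metric.ball (0 : E) r := mem_ball_zero_iff.2 (hp i (subset_closure hpi))
    have h2 := trivialization_bundleExp (he i) p hpb (hexp _ h1).2
    have h3 : (e i).toOpenPartialHomeomorph.symm (e i (bundleExp E G Γ p)) = bundleExp E G Γ p :=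
      (e i).toOpenPartialHomeomorph.left_inv ((e i).mem_source.2 hpb)
    have hfst : (L i p).1 = p.1 := (L i).coe_fst' (x := p) hpb
    have hBp : Bi i p = (e i).toOpenPartialHomeomorph.symm ((L i p).1, Θ (L i p).2) := rfl
    rw [← h3, h2, (hexp _ h1).1, hBp, hfst]
  have hcov : ∀ x : Ω, ∃ i, x ∈ T i := fun x => by
    exact mem_iUnion.1 (hTc.symm ▸ mem_univ x)
  have hNi : ∀ i, IsOpen {p | p ∈ N ∧ p.1 ∈ T i} := fun i => hNo.inter ((hTo i).preimage hproj)
  refine ⟨N, ⟨hNo, fun x i _ => ?_, ?_⟩, fun x v hv t ht i hi => ?_⟩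
  · have h := hLlin i x 0 0
    rw [zero_smul, zero_smul] at h
    rw [h, norm_zero]
    exact hr
  · refine IsOpenEmbedding.of_continuous_injective_isOpenMap ?_ ?_ ?_
    · refine ContinuousOn.domRestrict fun p hp => ContinuousAt.continuousWithinAt ?_
      obtain ⟨i, hi⟩ := hcov p.1
      refine ((Bi i).continuousAt (hBsrc i p hp hi)).congr ?_
      filter_upwards [(hNi i).mem_nhds ⟨hp, hi⟩] with q hq
      exact (hBeq i q hq.1 hq.2).symm
    · rintro ⟨p, hp⟩ ⟨q, hq⟩ hpq
      have hpq' : bundleExp E G Γ p = bundleExp E G Γ q := hpq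
      -- Since `bundleExp` preserves base points, both points lie over one `T i`, and local
      -- injectivity is enough.
      have h1 : p.1 = q.1 := congrArg (fun z : TotalSpace G Γ => z.1) hpq'
      obtain ⟨i, hi⟩ := hcov p.1
      have hi' : q.1 ∈ T i := h1 ▸ hi
      rw [hBeq i p hp hi, hBeq i q hq hi'] at hpq'
      exact Subtype.ext ((Bi i).injOn (hBsrc i p hp hi) (hBsrc i q hq hi') hpq')
    · intro V hV
      have hV' := hNo.isOpenMap_subtype_val V hV
      refine isOpen_iff_mem_nhds.2 ?_
      rintro _ ⟨⟨p, hp⟩, hpV, rfl⟩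
      obtain ⟨i, hi⟩ := hcov p.1
      have hsub : Subtype.val '' V ∩ {p | p ∈ N ∧ p.1 ∈ T i} ⊆ (Bi i).source := fun q hq =>
        hBsrc i q hq.2.1 hq.2.2
      refine mem_of_superset (((Bi i).isOpen_image_of_subset_source (hV'.inter (hNi i))
        hsub).mem_nhds ⟨p, ⟨⟨⟨p, hp⟩, hpV, rfl⟩, hp, hi⟩, (hBeq i p hp hi).symm⟩) ?_
      rintro _ ⟨q, ⟨⟨q', hq', rfl⟩, hqN, hqi⟩, rfl⟩
      exact ⟨q', hq', hBeq i _ hqN hqi⟩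
  · rw [hLlin, norm_smul, Real.norm_of_nonneg ht.1]
    exact lt_of_le_of_lt (mul_le_of_le_one_left (norm_nonneg _) ht.2) (hv i hi)

end NormalNeighborhoods

/-! ### Charts of the total space -/

section TotalSpaceCharts

variable {B E G : Type*} [TopologicalSpace B] [NormedAddCommGroup E] [TopologicalSpace G]
  [ChartedSpace E G] {P : B → Type*} [TopologicalSpace (TotalSpace G P)]
  [∀ x, TopologicalSpace (P x)] [FiberBundle G P]

variable (E G P) in
/-- The charts of the total space of a fibre bundle given by a trivialization and a chart of the
typical fibre. -/
noncomputable def totalSpaceChart (i : FiberBundle.trivializationAtlas G P × G) :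
    OpenPartialHomeomorph (TotalSpace G P) (B × E) :=
  i.1.1.toOpenPartialHomeomorph.trans ((OpenPartialHomeomorph.refl B).prod (chartAt E i.2))

lemma totalSpaceChart_apply (i : FiberBundle.trivializationAtlas G P × G) (z : TotalSpace G P) :
    totalSpaceChart E G P i z = ((i.1.1 z).1, chartAt E i.2 (i.1.1 z).2) := rfl

lemma totalSpaceChart_symm_apply (i : FiberBundle.trivializationAtlas G P × G) (q : B × E) :
    (totalSpaceChart E G P i).symm q =
      i.1.1.toOpenPartialHomeomorph.symm (q.1, (chartAt E i.2).symm q.2) := rfl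

lemma mem_totalSpaceChart_source {i : FiberBundle.trivializationAtlas G P × G}
    {z : TotalSpace G P} : z ∈ (totalSpaceChart E G P i).source ↔
      z.1 ∈ i.1.1.baseSet ∧ (i.1.1 z).2 ∈ (chartAt E i.2).source := by
  simp [totalSpaceChart, Trivialization.mem_source]

end TotalSpaceCharts

/-! ### Locally Lipschitz sections of smooth bundles -/

section BundleSections

variable {X : Type*} [NormedAddCommGroup X] [NormedSpace ℝ X] {Ω : Opens X}
  {E : Type*} [NormedAddCommGroup E] [NormedSpace ℝ E]

/-- A map of class `C^1` between open subsets of normed spaces is locally Lipschitz. -/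
lemma ContMDiffAt.lipAt {F : Ω × E → E} {p : Ω × E}
    (hF : ContMDiffAt (𝓘(ℝ, X).prod 𝓘(ℝ, E)) 𝓘(ℝ, E) 1 F p) : LipAt F p := by
  have h1 := (contMDiffAt_iff.1 hF).2
  have h2 : ContDiffAt ℝ 1 (fun y : X × E => F ((chartAt X p.1).symm y.1, y.2))
      ((p.1 : X), p.2) := by
    rw [← contDiffWithinAt_univ]
    have hr : range (𝓘(ℝ, X).prod 𝓘(ℝ, E)) = univ := ModelWithCorners.range_eq_univ _
    rw [hr] at h1
    exact h1
  have hval : LipAt (fun q : Ω × E => ((q.1 : X), q.2)) p :=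
    LipAt.prodMk (((LipschitzWith.subtype_val _).comp LipschitzWith.prod_fst).locallyLipschitz p)
      (LipschitzWith.prod_snd.locallyLipschitz p)
  refine (LipAt.comp (u := fun q : Ω × E => ((q.1 : X), q.2)) h2.lipAt hval).congr
    (Eventually.of_forall fun q => ?_)
  have hq : q.1 ∈ (chartAt X p.1).source := by
    rw [TopologicalSpace.Opens.chartAt_eq, OpenPartialHomeomorph.subtypeRestr_source]
    exact mem_univ _
  exact congrArg (fun y => F (y, q.2)) ((chartAt X p.1).left_inv hq).symm

variable {G : Type*} [TopologicalSpace G] [ChartedSpace E G]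
  {P : Ω → Type*} [TopologicalSpace (TotalSpace G P)] [∀ x, TopologicalSpace (P x)]
  [FiberBundle G P]

variable (E G P) in
-- A change of charts is an inverse chart of `G`, a change of trivialization and a chart of `G` in
-- succession: it is `C^3`, hence locally Lipschitz.
lemma isLipschitzAtlas_totalSpaceChart [IsManifold 𝓘(ℝ, E) 3 G]
    [IsContMDiffFiberBundle Ω E G 3 P] :
    IsLipschitzAtlas (fun z : TotalSpace G P => z.1) (totalSpaceChart E G P) where
  continuous_proj := FiberBundle.continuous_proj G P
  fst_eq i z hz := i.1.1.coe_fst' (mem_totalSpaceChart_source.1 hz).1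
  cover z := ⟨(⟨FiberBundle.trivializationAt G P z.1, FiberBundle.trivialization_mem_atlas G P z.1⟩,
    (FiberBundle.trivializationAt G P z.1 z).2), mem_totalSpaceChart_source.2
      ⟨FiberBundle.mem_baseSet_trivializationAt G P z.1, mem_chart_source E _⟩⟩
  lipAt_change i j z hi hj := by
    obtain ⟨hi1, hi2⟩ := mem_totalSpaceChart_source.1 hi
    obtain ⟨hj1, hj2⟩ := mem_totalSpaceChart_source.1 hj
    obtain ⟨⟨e, he⟩, a⟩ := i
    obtain ⟨⟨e', he'⟩, a'⟩ := j
    simp only at hi1 hi2 hj1 hj2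
    have hez : e z = (z.1, (e z).2) := Trivialization.mk_snd_apply e hi1 z.2
    have hpt : totalSpaceChart E G P (⟨e, he⟩, a) z = (z.1, chartAt E a (e z).2) := by
      rw [totalSpaceChart_apply]
      simp only
      rw [hez]
    rw [hpt]
    simp only [totalSpaceChart_apply, totalSpaceChart_symm_apply]
    refine ContMDiffAt.lipAt ?_
    have hc : ContMDiffAt (𝓘(ℝ, X).prod 𝓘(ℝ, E)) 𝓘(ℝ, E) 3
        (fun p : Ω × G => (e' (e.toOpenPartialHomeomorph.symm p)).2) (z.1, (e z).2) :=
      (IsContMDiffFiberBundle.contMDiffOn_coordChange e he e' he' :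
        ContMDiffOn _ _ _ _ _).contMDiffAt
        (((e.open_baseSet.inter e'.open_baseSet).prod isOpen_univ).mem_nhds
          ⟨⟨hi1, hj1⟩, mem_univ _⟩)
    have hinv : (chartAt E a).symm (chartAt E a (e z).2) = (e z).2 := (chartAt E a).left_inv hi2
    have hsymm : ContMDiffAt 𝓘(ℝ, E) 𝓘(ℝ, E) 3 (chartAt E a).symm (chartAt E a (e z).2) :=
      (contMDiffOn_chart_symm (I := 𝓘(ℝ, E)) (n := 3)).contMDiffAt
        ((chartAt E a).open_target.mem_nhds ((chartAt E a).map_source hi2))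
    have h1 : ContMDiffAt (𝓘(ℝ, X).prod 𝓘(ℝ, E)) (𝓘(ℝ, X).prod 𝓘(ℝ, E)) 3
        (fun q : Ω × E => (q.1, (chartAt E a).symm q.2)) (z.1, chartAt E a (e z).2) :=
      contMDiffAt_fst.prodMk (hsymm.comp (z.1, chartAt E a (e z).2) contMDiffAt_snd)
    have h2 : (e' (e.toOpenPartialHomeomorph.symm (z.1, (e z).2))).2 = (e' z).2 := by
      rw [Trivialization.symm_mk_snd e hi1 z.2]
    have hchart : ContMDiffAt 𝓘(ℝ, E) 𝓘(ℝ, E) 3 (chartAt E a') (e' z).2 :=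
      (contMDiffOn_chart (I := 𝓘(ℝ, E)) (n := 3)).contMDiffAt
        ((chartAt E a').open_source.mem_nhds hj2)
    rw [← hinv] at hc
    have h3 := ContMDiffAt.comp (z.1, chartAt E a (e z).2) hc h1
    rw [← h2, ← hinv] at hchart
    exact (ContMDiffAt.comp (z.1, chartAt E a (e z).2) hchart h3).of_le (by norm_num)

/-- Every neighbourhood of a continuous section of a smooth fibre bundle contains a locally
Lipschitz section. -/
theorem exists_isLocallyLipschitzSection [SeparableSpace X] [IsManifold 𝓘(ℝ, E) 3 G]
    [IsContMDiffFiberBundle Ω E G 3 P] {f : ∀ x, P x} (hf : IsContinuousSection G f)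
    {W : Set (TotalSpace G P)} (hW : IsOpen W) (hfW : ∀ x, (⟨x, f x⟩ : TotalSpace G P) ∈ W) :
    ∃ g : ∀ x, P x, IsLocallyLipschitzSection E G g ∧ IsContinuousSection G g ∧
      ∀ x, (⟨x, g x⟩ : TotalSpace G P) ∈ W := by
  have : SecondCountableTopology X := UniformSpace.secondCountable_of_separable X
  obtain ⟨s, hs, hsc, hsW, hsl⟩ := (isLipschitzAtlas_totalSpaceChart E G P).exists_lipschitz_section
    hW (s := fun x => (⟨x, f x⟩ : TotalSpace G P)) (fun x => rfl) hf hfW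
  have hg : ∀ x, ∃ b : P x, s x = ⟨x, b⟩ := fun x => by
    have h := hs x
    generalize s x = z at h
    obtain ⟨y, b⟩ := z
    obtain rfl : y = x := h
    exact ⟨b, rfl⟩
  choose g hg using hg
  obtain rfl : s = fun x => (⟨x, g x⟩ : TotalSpace G P) := funext hg
  refine ⟨g, fun e he x hx => ⟨?_, ?_⟩, hsc, hsW⟩
  · exact continuous_snd.continuousAt.comp ((e.continuousAt (e.mem_source.2 hx)).comp
      (f := fun x => (⟨x, g x⟩ : TotalSpace G P)) hsc.continuousAt)
  · exact hsl x (⟨e, he⟩, (e ⟨x, g x⟩).2)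
      (mem_totalSpaceChart_source.2 ⟨hx, mem_chart_source E _⟩)

end BundleSections

/-! ### Division in principal bundles and sections of the form `f · exp v` -/

section PrincipalBundles

variable {X : Type*} [NormedAddCommGroup X] [NormedSpace ℝ X] {Ω : Opens X}
  {E : Type*} [NormedAddCommGroup E] [NormedSpace ℝ E]
  {G : Type*} [TopologicalSpace G] [ChartedSpace E G] [Group G]
  {Γ : Ω → Type*} [TopologicalSpace (TotalSpace G Γ)] [∀ x, TopologicalSpace (Γ x)]
  [∀ x, Group (Γ x)] [FiberBundle G Γ]
  {P : Ω → Type*} [TopologicalSpace (TotalSpace G P)] [∀ x, TopologicalSpace (P x)]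
  [FiberBundle G P] [∀ x, MulAction (Γ x)ᵐᵒᵖ (P x)]

section Fiberwise

variable (E G)

/-- In an equivariant trivialization the action is right translation of `G`, which is transitive:
the divisor corresponds to `(e p)⁻¹ * e q`. -/
lemma op_torsorDiv_smul [IsRightPrincipalBundle Ω E G 3 Γ P] {x : Ω} (p q : P x) :
    op (torsorDiv p q : Γ x) • p = q := by
  obtain ⟨e, -, τ, -, hx, h⟩ :=
    IsRightPrincipalBundle.exists_equivariant (E := E) (G := G) (n := 3) (Γ := Γ) (P := P) x
  obtain ⟨a, ha⟩ := Trivialization.snd_surjective τ hx.2 ((e ⟨x, p⟩).2⁻¹ * (e ⟨x, q⟩).2)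
  refine Classical.epsilon_spec (p := fun a : Γ x => op a • p = q) ⟨a, ?_⟩
  refine Trivialization.snd_injective e hx.1 ?_
  simp only at ha ⊢
  rw [h x hx, ha, mul_inv_cancel_left]

lemma op_smul_left_injective [IsRightPrincipalBundle Ω E G 3 Γ P] {x : Ω} (p : P x) :
    Function.Injective fun a : Γ x => op a • p := fun a b hab => by
  obtain ⟨e, -, τ, -, hx, h⟩ :=
    IsRightPrincipalBundle.exists_equivariant (E := E) (G := G) (n := 3) (Γ := Γ) (P := P) x
  refine Trivialization.snd_injective τ hx.2 ?_
  have h1 := h x hx p a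
  rw [show op a • p = op b • p from hab, h x hx p b] at h1
  exact (mul_left_cancel h1).symm

lemma torsorDiv_self [IsRightPrincipalBundle Ω E G 3 Γ P] {x : Ω} (p : P x) :
    (torsorDiv p p : Γ x) = 1 :=
  op_smul_left_injective E G p (by simp [op_torsorDiv_smul E G p p])

end Fiberwise

lemma continuousAt_totalSpace_mk {B F S : Type*} [TopologicalSpace B] [TopologicalSpace F]
    [TopologicalSpace S] {Q : B → Type*} [TopologicalSpace (TotalSpace F Q)]
    (e : Trivialization F (π F Q)) {u : S → B} {s : ∀ t, Q (u t)} {t₀ : S}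
    (hu : ContinuousAt u t₀) (ht : u t₀ ∈ e.baseSet)
    (hs : ContinuousAt (fun t => (e ⟨u t, s t⟩).2) t₀) :
    ContinuousAt (fun t => (⟨u t, s t⟩ : TotalSpace F Q)) t₀ := by
  refine e.continuousAt_of_comp_left hu ht ((hu.prodMk hs).congr ?_)
  filter_upwards [hu (e.open_baseSet.mem_nhds ht)] with t ht
  exact (Trivialization.mk_snd_apply e ht (s t)).symm

lemma continuousAt_snd_trivialization {B F S : Type*} [TopologicalSpace B] [TopologicalSpace F]
    [TopologicalSpace S] {Q : B → Type*} [TopologicalSpace (TotalSpace F Q)]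
    (e : Trivialization F (π F Q)) {u : S → B} {s : ∀ t, Q (u t)} {t₀ : S}
    (ht : u t₀ ∈ e.baseSet)
    (hs : ContinuousAt (fun t => (⟨u t, s t⟩ : TotalSpace F Q)) t₀) :
    ContinuousAt (fun t => (e ⟨u t, s t⟩).2) t₀ :=
  continuous_snd.continuousAt.comp ((e.continuousAt (e.mem_source.2 ht)).comp
    (f := fun t => (⟨u t, s t⟩ : TotalSpace F Q)) hs)

variable {S : Type*} [TopologicalSpace S] {u : S → Ω}

variable (E) in
lemma continuous_op_smul [LieGroup 𝓘(ℝ, E) 3 G] [IsRightPrincipalBundle Ω E G 3 Γ P]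
    {p : ∀ t, P (u t)} {a : ∀ t, Γ (u t)}
    (hp : Continuous fun t => (⟨u t, p t⟩ : TotalSpace G P))
    (ha : Continuous fun t => (⟨u t, a t⟩ : TotalSpace G Γ)) :
    Continuous fun t => (⟨u t, op (a t) • p t⟩ : TotalSpace G P) := by
  have : IsTopologicalGroup G := topologicalGroup_of_lieGroup 𝓘(ℝ, E) 3
  have hu : Continuous u := (FiberBundle.continuous_proj G P).comp hp
  refine continuous_iff_continuousAt.2 fun t₀ => ?_
  obtain ⟨e, -, τ, -, hx, h⟩ := IsRightPrincipalBundle.exists_equivariant (E := E) (G := G) (n := 3)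
    (Γ := Γ) (P := P) (u t₀)
  refine continuousAt_totalSpace_mk e hu.continuousAt hx.1
    (((continuousAt_snd_trivialization e hx.1 hp.continuousAt).mul
      (continuousAt_snd_trivialization τ hx.2 ha.continuousAt)).congr ?_)
  filter_upwards [hu.continuousAt ((e.open_baseSet.inter τ.open_baseSet).mem_nhds hx)] with t ht
  exact (h _ ht _ _).symm

variable (E) in
-- Locally `τ (p⁻¹ q) = (e p)⁻¹ * e q`. The parameter space `S` is general because both `Ω` and the
-- total space of `P` are needed.
lemma continuous_torsorDiv [LieGroup 𝓘(ℝ, E) 3 G] [IsRightPrincipalBundle Ω E G 3 Γ P]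
    {p q : ∀ t, P (u t)} (hp : Continuous fun t => (⟨u t, p t⟩ : TotalSpace G P))
    (hq : Continuous fun t => (⟨u t, q t⟩ : TotalSpace G P)) :
    Continuous fun t => (⟨u t, torsorDiv (p t) (q t)⟩ : TotalSpace G Γ) := by
  have : IsTopologicalGroup G := topologicalGroup_of_lieGroup 𝓘(ℝ, E) 3
  have hu : Continuous u := (FiberBundle.continuous_proj G P).comp hp
  refine continuous_iff_continuousAt.2 fun t₀ => ?_
  obtain ⟨e, -, τ, -, hx, h⟩ := IsRightPrincipalBundle.exists_equivariant (E := E) (G := G) (n := 3)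
    (Γ := Γ) (P := P) (u t₀)
  refine continuousAt_totalSpace_mk τ hu.continuousAt hx.2
    (((continuousAt_snd_trivialization e hx.1 hp.continuousAt).inv.mul
      (continuousAt_snd_trivialization e hx.1 hq.continuousAt)).congr ?_)
  filter_upwards [hu.continuousAt ((e.open_baseSet.inter τ.open_baseSet).mem_nhds hx)] with t ht
  have h1 := h _ ht (p t) (torsorDiv (p t) (q t))
  rw [op_torsorDiv_smul E G] at h1
  exact inv_mul_eq_of_eq_mul h1

variable [IsLieGroupBundle Ω E G 3 Γ] [LieGroup 𝓘(ℝ, E) 3 G]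

/-- A continuous section `f` of a principal bundle can be approximated by locally Lipschitz sections
of the form `f * exp v`, with `v` in a given neighbourhood of the zero section of the Lie algebra
bundle. -/
theorem exists_isLocallyLipschitzSection_torsorDiv_eq [SeparableSpace X]
    [IsRightPrincipalBundle Ω E G 3 Γ P] {N N' : Set (TotalSpace E (LieFiber E G Γ))}
    (hN : IsNormalNeighborhood E G Γ N) (hN'N : N' ⊆ N) (hN' : IsOpen N')
    (h0 : ∀ x : Ω, (⟨x, 0⟩ : TotalSpace E (LieFiber E G Γ)) ∈ N')
    {f : ∀ x, P x} (hf : IsContinuousSection G f) :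
    ∃ g : ∀ x, P x, IsLocallyLipschitzSection E G g ∧ IsContinuousSection G g ∧
      ∀ x, ∃ v : LieFiber E G Γ x, (⟨x, v⟩ : TotalSpace E (LieFiber E G Γ)) ∈ N' ∧
        fiberExp E G Γ x v = torsorDiv (f x) (g x) := by
  have : IsManifold 𝓘(ℝ, E) 3 G := inferInstance
  have himg : IsOpen (bundleExp E G Γ '' N') := by
    have h := hN.isOpenEmbedding.isOpenMap _ (hN'.preimage continuous_subtype_val)
    convert! h using 1
    ext z
    constructor
    · rintro ⟨p, hp, rfl⟩
      exact ⟨⟨p, hN'N hp⟩, hp, rfl⟩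
    · rintro ⟨⟨p, _⟩, hp, rfl⟩
      exact ⟨p, hp, rfl⟩
  have hcont : Continuous fun p : TotalSpace G P =>
      (⟨p.1, torsorDiv (f p.1) p.2⟩ : TotalSpace G Γ) :=
    continuous_torsorDiv E (u := fun p : TotalSpace G P => p.1)
      (Continuous.comp hf (FiberBundle.continuous_proj G P)) continuous_id
  -- The neighbourhood of `f` is the set of `p` with `f⁻¹ p ∈ exp N'`; `f` itself corresponds to the
  -- zero vector.
  obtain ⟨g, hg, hgc, hgW⟩ := exists_isLocallyLipschitzSection (E := E) hf (himg.preimage hcont)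
    fun x => ⟨⟨x, 0⟩, h0 x, by
      simp only [bundleExp, fiberExp_zero, torsorDiv_self E G]⟩
  refine ⟨g, hg, hgc, fun x => ?_⟩
  obtain ⟨⟨y, v⟩, hv, hvx⟩ := hgW x
  obtain rfl : y = x := congrArg (fun z : TotalSpace G Γ => z.1) hvx
  exact ⟨v, hv, TotalSpace.mk_injective y hvx⟩

lemma IsNormalNeighborhood.injOn_fiberExp {N : Set (TotalSpace E (LieFiber E G Γ))}
    (hN : IsNormalNeighborhood E G Γ N) (x : Ω) :
    InjOn (fiberExp E G Γ x) (fiberPart N x) := fun v hv w hw hvw => by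
  have h : N.domRestrict (bundleExp E G Γ) ⟨⟨x, v⟩, hv⟩ =
      N.domRestrict (bundleExp E G Γ) ⟨⟨x, w⟩, hw⟩ := congrArg (TotalSpace.mk x) hvw
  exact TotalSpace.mk_injective x (congrArg Subtype.val (hN.isOpenEmbedding.injective h))

lemma continuous_smul_section {v : ∀ x, LieFiber E G Γ x}
    (hv : Continuous fun x => (⟨x, v x⟩ : TotalSpace E (LieFiber E G Γ))) :
    Continuous fun p : Ω × unitInterval =>
      (⟨p.1, (p.2 : ℝ) • v p.1⟩ : TotalSpace E (LieFiber E G Γ)) := by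
  refine continuous_iff_continuousAt.2 fun p => ?_
  let L := (lieAlgebraBundle E G Γ).localTriv ((lieAlgebraBundle E G Γ).indexAt p.1)
  have hp : p.1 ∈ L.baseSet := (lieAlgebraBundle E G Γ).mem_baseSet_at p.1
  refine continuousAt_totalSpace_mk L continuousAt_fst hp ?_
  have h1 : ContinuousAt (fun x => (L ⟨x, v x⟩).2) p.1 :=
    continuousAt_snd_trivialization L (u := fun x => x) hp hv.continuousAt
  have h2 : ContinuousAt (fun q : Ω × unitInterval => (q.2 : ℝ) • (L ⟨q.1, v q.1⟩).2) p :=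
    (continuous_subtype_val.comp continuous_snd).continuousAt.smul
      (ContinuousAt.comp (f := Prod.fst) h1 continuousAt_fst)
  refine h2.congr (Eventually.of_forall fun q => ?_)
  simp only [L, VectorBundleCore.localTriv_apply]
  exact (ContinuousLinearMap.map_smul _ (q.2 : ℝ) (v q.1)).symm

end PrincipalBundles

/-! ### The main theorem -/

theorem theorem8p2
    {X : Type*} [NormedAddCommGroup X] [NormedSpace ℝ X] [CompleteSpace X] [SeparableSpace X]
    (Ω : Opens X)
    {E : Type*} [NormedAddCommGroup E] [NormedSpace ℝ E] [CompleteSpace E]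
    {G : Type*} [TopologicalSpace G] [ChartedSpace E G] [Group G] [LieGroup 𝓘(ℝ, E) 3 G]
    (Γ : Ω → Type*) [TopologicalSpace (TotalSpace G Γ)] [∀ x, TopologicalSpace (Γ x)]
    [∀ x, Group (Γ x)] [FiberBundle G Γ] [IsLieGroupBundle Ω E G 3 Γ]
    (nrm : ContinuousNorm E G Γ)
    (P : Ω → Type*) [TopologicalSpace (TotalSpace G P)] [∀ x, TopologicalSpace (P x)]
    [FiberBundle G P] [∀ x, MulAction (Γ x)ᵐᵒᵖ (P x)] [IsRightPrincipalBundle Ω E G 3 Γ P] :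
    -- normal neighbourhoods exist, so that the logarithm is defined
    (∃ N, IsNormalNeighborhood E G Γ N) ∧
    -- approximation of continuous sections by locally Lipschitz ones
    (∀ N, IsNormalNeighborhood E G Γ N →
      ∀ f : ∀ x, P x, IsContinuousSection G f →
      ∀ ε : Ω → ℝ, Continuous ε → (∀ x, 0 < ε x) →
        ∃ g : ∀ x, P x, IsLocallyLipschitzSection E G g ∧
          ∀ x, torsorDiv (f x) (g x) ∈ fiberExp E G Γ x '' fiberPart N x ∧
            nrm.toFun x (fiberLog N x (torsorDiv (f x) (g x))) ≤ ε x) ∧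
    -- homotopy of continuous sections to locally Lipschitz ones
    (∀ f : ∀ x, P x, IsContinuousSection G f →
      ∃ g : ∀ x, P x, IsLocallyLipschitzSection E G g ∧
        ∃ h : ∀ x, unitInterval → P x,
          (Continuous fun p : Ω × unitInterval => (⟨p.1, h p.1 p.2⟩ : TotalSpace G P)) ∧
          ∀ x, h x 0 = f x ∧ h x 1 = g x) := by

  refine ⟨?_, fun N hN f hf ε hε hεpos => ?_, fun f hf => ?_⟩
  · obtain ⟨N, hN, -⟩ := exists_isNormalNeighborhood E G Γ
    exact ⟨N, hN⟩
  · obtain ⟨g, hg, -, hv⟩ := exists_isLocallyLipschitzSection_torsorDiv_eq (P := P) hN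
      (N' := N ∩ {p | nrm.toFun p.1 p.2 < ε p.1}) inter_subset_left
      (hN.isOpen.inter (isOpen_lt nrm.continuous
        (hε.comp (FiberBundle.continuous_proj E (LieFiber E G Γ)))))
      (fun x => ⟨hN.zero_mem x, by simpa using hεpos x⟩) hf
    refine ⟨g, hg, fun x => ?_⟩
    obtain ⟨v, ⟨hvN, hvε⟩, hvx⟩ := hv x
    -- The logarithm is taken relative to all of `N`; injectivity of `exp` there identifies it with
    -- the `v` found in the smaller set.
    have hlog : fiberLog N x (torsorDiv (f x) (g x)) = v := by
      rw [← hvx]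
      exact (hN.injOn_fiberExp x).leftInvOn_invFunOn hvN
    exact ⟨⟨v, hvN, hvx⟩, hlog.symm ▸ le_of_lt hvε⟩
  · obtain ⟨N, hN, hstar⟩ := exists_isNormalNeighborhood E G Γ
    obtain ⟨g, hg, hgc, hv⟩ := exists_isLocallyLipschitzSection_torsorDiv_eq (P := P) hN
      subset_rfl hN.isOpen hN.zero_mem hf
    choose v hvN hvx using hv
    -- `v` was chosen pointwise. It is continuous because `exp` is an embedding on `N` and `exp v =
    -- f⁻¹ g` is continuous.
    have hvc : Continuous fun x => (⟨x, v x⟩ : TotalSpace E (LieFiber E G Γ)) := by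
      have h1 : Continuous fun x => (⟨⟨x, v x⟩, hvN x⟩ : N) := by
        rw [hN.isOpenEmbedding.isInducing.continuous_iff]
        refine (continuous_torsorDiv E (Γ := Γ) (u := fun x => x) hf hgc).congr fun x => ?_
        exact congrArg (TotalSpace.mk x) (hvx x).symm
      exact continuous_subtype_val.comp h1
    have hexp : Continuous fun p : Ω × unitInterval =>
        (⟨p.1, fiberExp E G Γ p.1 ((p.2 : ℝ) • v p.1)⟩ : TotalSpace G Γ) :=
      hN.isOpenEmbedding.continuous.comp ((continuous_smul_section hvc).subtype_mk
        fun p => hstar _ _ (hvN p.1) p.2 p.2.2)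
    -- The homotopy is `f · exp (t v)`; star-shapedness keeps `t v` in `N`, where `exp` is known to
    -- be continuous.
    refine ⟨g, hg, fun x t => op (fiberExp E G Γ x ((t : ℝ) • v x)) • f x,
      continuous_op_smul E (u := fun p : Ω × unitInterval => p.1)
        (Continuous.comp hf continuous_fst) hexp, fun x => ⟨?_, ?_⟩⟩
    · simp [fiberExp_zero]
    · simp [hvx, op_torsorDiv_smul E G]
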